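/- Let $M$ be a smooth (finite-dimensional, Hausdorff, boundaryless) manifold and let $X$ be a smooth complete vector field on $M$, that is, through every point of $M$ there is an integral curve of $X$ defined on all of $\mathbb{R}$. Let $\varphi_X^t(q)$ be the value at time $t$ of the integral curve of $X$ starting at $q$. For a diffeomorphism $\Phi : M \to M$ let $\hat\Phi : T^*M \to T^*M$ be its lift, which maps a covector $p_q \in T_q^*M$ to $(\Phi^{-1})^* p_q = p_q \circ d(\Phi^{-1})_{\Phi(q)} \in T^*_{\Phi(q)}M$. Let $\theta$ be the tautological $1$-form on $T^*M$, $\theta_p(v) = p(d\pi_p(v))$, where $\pi : T^*M \to M$ is the projection, and let $\alpha = -d\theta$. The cotangent lift $\hat X$ of $X$ is given by $$\hat X_p = \frac{d}{dt}\Big|_{t=0} \widehat{(\varphi_X^t)}(p), \qquad p \in T^*M.$$ Then: 1. $(\varphi_X^t)_{t\in\mathbb{R}}$ is a smooth global flow on $M$ (a smooth action of $\mathbb{R}$), and its lifts $\big(\widehat{(\varphi_X^t)}\big)_{t\in\mathbb{R}}$ form a smooth global flow on $T^*M$. 2. $\hat X$ is a smooth complete vector field on $T^*M$ that generates the lifted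 flow: $\varphi_{\hat X}^t = \widehat{(\varphi_X^t)}$ for all $t \in \mathbb{R}$. 3. $\alpha$ is a symplectic form on $T^*M$ (smooth, closed and nondegenerate), and $\hat X$ is the Hamiltonian vector field with respect to $\alpha$ of the smooth function $H_X : T^*M \to \mathbb{R}$, $H_X(p_q) = p_q(X_q)$; that is, $\alpha(\hat X, \cdot) = dH_X$. -/

import Mathlib

open Bundle Set Function
open scoped Manifold ContDiff Topology

noncomputable section

/-! ### Vector fields and flows -/

section Flows

variable {E : Type*} [NormedAddCommGroup E] [NormedSpace ℝ E]
  {H : Type*} [TopologicalSpace H] (I : ModelWithCorners ℝ E H)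
  {N : Type*} [TopologicalSpace N] [ChartedSpace H N]

/-- A smooth vector field on `N`: a smooth section of the tangent bundle. -/
def IsSmoothVectorField [IsManifold I 1 N] (X : (x : N) → TangentSpace I x) : Prop :=
  ContMDiff I I.tangent ∞ (fun x ↦ (⟨x, X x⟩ : TangentBundle I N))

/-- A vector field is complete if through every point there is an integral curve that is defined
for all times. -/
def IsCompleteVectorField (X : (x : N) → TangentSpace I x) : Prop :=
  ∀ x : N, ∃ γ : ℝ → N, γ 0 = x ∧ IsMIntegralCurve (I := I) γ X

/-- The flow of a complete vector field: `flowOf I X hX t x` is the value at time `t` of the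
integral curve of `X` that starts at `x`. (This curve is unique on a Hausdorff manifold without
boundary if `X` is smooth.) -/
def flowOf (X : (x : N) → TangentSpace I x) (hX : IsCompleteVectorField I X) (t : ℝ) (x : N) : N :=
  (hX x).choose t

variable {I}

theorem flowOf_zero {X : (x : N) → TangentSpace I x} (hX : IsCompleteVectorField I X) (x : N) :
    flowOf I X hX 0 x = x :=
  (hX x).choose_spec.1

theorem isMIntegralCurve_flowOf {X : (x : N) → TangentSpace I x}
    (hX : IsCompleteVectorField I X) (x : N) :
    IsMIntegralCurve (I := I) (fun t ↦ flowOf I X hX t x) X :=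
  (hX x).choose_spec.2

theorem flowOf_add [IsManifold I 1 N] [BoundarylessManifold I N] [T2Space N] [FiniteDimensional ℝ E]
    {X : (x : N) → TangentSpace I x} (hXs : IsSmoothVectorField I X)
    (hX : IsCompleteVectorField I X) (s t : ℝ) (x : N) :
    flowOf I X hX s (flowOf I X hX t x) = flowOf I X hX (s + t) x := by
  have : CompleteSpace E := FiniteDimensional.complete ℝ E
  have h := isMIntegralCurve_Ioo_eq_of_contMDiff_boundaryless (t₀ := (0 : ℝ))
    (ContMDiff.of_le hXs (by simp)) (isMIntegralCurve_flowOf hX (flowOf I X hX t x))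
    ((isMIntegralCurve_flowOf hX x).comp_add t) (by simp [flowOf_zero])
  exact congrFun h s

variable (I)

/-- The time-`t` map of the flow of a smooth complete vector field, as a bijection of the manifold
with inverse the time-`(-t)` map. -/
def flowEquiv [IsManifold I 1 N] [BoundarylessManifold I N] [T2Space N] [FiniteDimensional ℝ E]
    (X : (x : N) → TangentSpace I x) (hXs : IsSmoothVectorField I X)
    (hX : IsCompleteVectorField I X) (t : ℝ) : N ≃ N where
  toFun := flowOf I X hX t
  invFun := flowOf I X hX (-t)
  left_inv x := by rw [flowOf_add hXs, neg_add_cancel, flowOf_zero]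
  right_inv x := by rw [flowOf_add hXs, add_neg_cancel, flowOf_zero]

/-- A smooth global flow on `N`: a smooth action of the additive group `ℝ` on `N`. -/
structure IsSmoothGlobalFlow (φ : ℝ → N → N) : Prop where
  smooth : ContMDiff (𝓘(ℝ, ℝ).prod I) I ∞ (fun z : ℝ × N ↦ φ z.1 z.2)
  zero : ∀ x, φ 0 x = x
  add : ∀ s t x, φ s (φ t x) = φ (s + t) x

end Flows

/-! ### Differential forms, symplectic forms, Hamiltonian vector fields -/

section Forms

variable {E : Type*} [NormedAddCommGroup E] [NormedSpace ℝ E]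
  {H : Type*} [TopologicalSpace H] (I : ModelWithCorners ℝ E H)
  {N : Type*} [TopologicalSpace N] [ChartedSpace H N]

/-- The expression of a differential `k`-form on `N` in the preferred chart at `x₀`: its pullback
under the inverse of this chart, a `k`-form on the model vector space. -/
def formInChart {k : ℕ} (α : (x : N) → TangentSpace I x [⋀^Fin k]→L[ℝ] ℝ) (x₀ : N) :
    E → E [⋀^Fin k]→L[ℝ] ℝ :=
  fun y ↦ (α ((extChartAt I x₀).symm y)).compContinuousLinearMap
    (mfderivWithin 𝓘(ℝ, E) I (extChartAt I x₀).symm (range I) y)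

/-- A differential form on `N` is smooth if it is smooth in the charts. -/
def IsSmoothForm {k : ℕ} (α : (x : N) → TangentSpace I x [⋀^Fin k]→L[ℝ] ℝ) : Prop :=
  ∀ x₀ : N, ContDiffOn ℝ ∞ (formInChart I α x₀) (extChartAt I x₀).target

/-- The exterior derivative of a differential form on `N`, computed at `x` in the preferred chart
at `x`, and pulled back to `N` by this chart. -/
def extDerivForm {k : ℕ} (α : (x : N) → TangentSpace I x [⋀^Fin k]→L[ℝ] ℝ) (x : N) :
    TangentSpace I x [⋀^Fin (k + 1)]→L[ℝ] ℝ :=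
  (extDerivWithin (formInChart I α x) (range I) (extChartAt I x x)).compContinuousLinearMap
    (mfderiv I 𝓘(ℝ, E) (extChartAt I x) x)

/-- A symplectic form: a smooth closed `2`-form `α` such that `v ↦ α (v, ·)` is an isomorphism from
the tangent space to its dual, at every point. -/
structure IsSymplecticForm (α : (x : N) → TangentSpace I x [⋀^Fin 2]→L[ℝ] ℝ) : Prop where
  smooth : IsSmoothForm I α
  closed : ∀ x, extDerivForm I α x = 0
  nondegenerate : ∀ (x : N) (l : TangentSpace I x →L[ℝ] ℝ),
    ∃! v : TangentSpace I x, ∀ w : TangentSpace I x, α x ![v, w] = l w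

/-- `Y` is the Hamiltonian vector field with (smooth) Hamiltonian function `h` on the symplectic
manifold `(N, α)`: the contraction of `α` with `Y` is `dh`. -/
structure IsHamiltonianVectorField [IsManifold I 1 N]
    (α : (x : N) → TangentSpace I x [⋀^Fin 2]→L[ℝ] ℝ)
    (Y : (x : N) → TangentSpace I x) (h : N → ℝ) : Prop where
  symplectic : IsSymplecticForm I α
  smooth_field : IsSmoothVectorField I Y
  smooth_hamiltonian : ContMDiff I 𝓘(ℝ, ℝ) ∞ h
  contraction : ∀ (x : N) (w : TangentSpace I x), α x ![Y x, w] = mfderiv I 𝓘(ℝ, ℝ) h x w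

end Forms

/-! ### The cotangent bundle -/

section Cotangent

variable (E : Type*) [NormedAddCommGroup E] [NormedSpace ℝ E]
  (M : Type*) [TopologicalSpace M] [ChartedSpace E M] [IsManifold 𝓘(ℝ, E) ∞ M]

/-- The cotangent bundle of a manifold modelled on `E`: the total space of the bundle of continuous
linear functionals on the tangent spaces. -/
abbrev CotangentBundle : Type _ :=
  TotalSpace (E →L[ℝ] ℝ) (fun x : M ↦ TangentSpace 𝓘(ℝ, E) x →L[ℝ] Trivial M ℝ x)

/-- The model with corners of the cotangent bundle of a manifold modelled on `E`. -/
abbrev cotangentModel : ModelWithCorners ℝ (E × (E →L[ℝ] ℝ)) (ModelProd E (E →L[ℝ] ℝ)) :=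
  𝓘(ℝ, E).prod 𝓘(ℝ, E →L[ℝ] ℝ)

/-- The tautological `1`-form on the cotangent bundle, `θ_p (v) = p (dπ_p v)`. -/
def tautologicalForm (p : CotangentBundle E M) :
    TangentSpace (cotangentModel E) p [⋀^Fin 1]→L[ℝ] ℝ :=
  ContinuousAlternatingMap.ofSubsingleton ℝ (TangentSpace (cotangentModel E) p) ℝ (0 : Fin 1)
    (ContinuousLinearMap.comp (show TangentSpace 𝓘(ℝ, E) p.proj →L[ℝ] ℝ from p.snd)
      (mfderiv (cotangentModel E) 𝓘(ℝ, E) (fun r : CotangentBundle E M ↦ r.proj) p))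

/-- The canonical symplectic form on the cotangent bundle, `α = -dθ`. -/
def canonicalForm (p : CotangentBundle E M) :
    TangentSpace (cotangentModel E) p [⋀^Fin 2]→L[ℝ] ℝ :=
  -extDerivForm (cotangentModel E) (tautologicalForm E M) p

variable {E M}

/-- The function `p_q ↦ p (X_q)` on the cotangent bundle. -/
def hamiltonianFunction (X : (q : M) → TangentSpace 𝓘(ℝ, E) q) (p : CotangentBundle E M) : ℝ :=
  p.snd (X p.proj)

/-- The lift of a diffeomorphism `Φ` of `M` to the cotangent bundle: the covector `p` at `q` goes
to the covector `(Φ⁻¹)^* p = p ∘ d(Φ⁻¹)_{Φ q}` at `Φ q`. (`d(Φ⁻¹)_{Φ q}` has values in the tangent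
space at `Φ⁻¹ (Φ q)`, that is, at `q`.) -/
def liftCotangent (Φ : M ≃ M) (p : CotangentBundle E M) : CotangentBundle E M :=
  ⟨Φ p.proj, ContinuousLinearMap.comp (show TangentSpace 𝓘(ℝ, E) p.proj →L[ℝ] ℝ from p.snd)
    (show TangentSpace 𝓘(ℝ, E) (Φ p.proj) →L[ℝ] TangentSpace 𝓘(ℝ, E) p.proj from
      mfderiv 𝓘(ℝ, E) 𝓘(ℝ, E) Φ.symm (Φ p.proj))⟩

/-- The cotangent lift of a smooth complete vector field `X`: the infinitesimal generator of the
lifts to the cotangent bundle of the maps `φ^t` of the flow of `X`. At `p` it is the velocity at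
`t = 0` of the curve that sends `t` to the lift of `φ^t` applied to `p`. (This curve is at `p` for
`t = 0`, so that its velocity there is a tangent vector at `p`.) -/
def cotangentLift [FiniteDimensional ℝ E] [T2Space M] (X : (q : M) → TangentSpace 𝓘(ℝ, E) q)
    (hXs : IsSmoothVectorField 𝓘(ℝ, E) X)
    (hX : IsCompleteVectorField 𝓘(ℝ, E) X) (p : CotangentBundle E M) :
    TangentSpace (cotangentModel E) p :=
  show TangentSpace (cotangentModel E) p from
    mfderiv 𝓘(ℝ, ℝ) (cotangentModel E)
      (fun t : ℝ ↦ liftCotangent (flowEquiv 𝓘(ℝ, E) X hXs hX t) p) 0 (1 : ℝ)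

end Cotangent

end

/-! Smoothness of the flow of `X` is smooth dependence of an ODE on its initial value. In a chart
the equation reads `γ = x + s ∫ f ∘ γ` in the Banach space `C([-1,1], E)`. Its derivative in `γ` at
`s = 0` is the identity, and `γ ↦ f ∘ γ` is smooth, so the implicit function theorem solves it
smoothly in `(s, x)` (`exists_contDiffAt_solution`). Rescaling time makes the flow smooth near time
`0`, and the group law with a connectedness argument in `ℝ` carries this to all times
(`isSmoothGlobalFlow_flowOf`).

The lifts form a one-parameter group by the chain rule, smooth because in bundle charts they are
composites of smooth families of operators (`isSmoothGlobalFlow_liftCotangent`). Any smooth global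
flow has a smooth generator whose integral curves are its orbits. `cotangentLift` is the generator
of the lifted flow, and uniqueness of integral curves on the Hausdorff manifold `T*M` gives the
second claim.

In a bundle chart with coordinates `(y, ξ)` the tautological form is `ξ dy`, so `α` is the constant
form `α(a, b) = b.2 a.1 - a.2 b.1`, visibly closed and nondegenerate. Along the lifted flow `ξ_t ∘
Dφ^t` stays equal to `ξ_0`. Differentiating at `0`, with symmetry of mixed derivatives, gives `X̂ =
(X, -ξ ∘ DX)` (`cotangentLift_inChart`). Hence `α(X̂, w) = w.2 (X) + ξ (DX w.1)`, the differential
of `ξ (X y)`. -/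

/-! ### Composition operators on spaces of continuous maps -/

section CompositionOperator

open Filter

universe u
variable {K : Type*} [TopologicalSpace K] [CompactSpace K]
  {E : Type u} [NormedAddCommGroup E] [NormedSpace ℝ E]
  {F : Type u} [NormedAddCommGroup F] [NormedSpace ℝ F]

/-- Pointwise application of a continuous bilinear map to two continuous maps, as a continuous
bilinear map. -/
noncomputable def ContinuousMap.pointwiseBilin (K : Type*) [TopologicalSpace K] [CompactSpace K]
    {G E F : Type*} [NormedAddCommGroup G] [NormedSpace ℝ G] [NormedAddCommGroup E]
    [NormedSpace ℝ E] [NormedAddCommGroup F] [NormedSpace ℝ F] (B : G →L[ℝ] E →L[ℝ] F) :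
    C(K, G) →L[ℝ] C(K, E) →L[ℝ] C(K, F) :=
  LinearMap.mkContinuous₂
    (LinearMap.mk₂ ℝ (fun (A : C(K, G)) (h : C(K, E)) ↦
      (⟨fun k ↦ B (A k) (h k), by fun_prop⟩ : C(K, F)))
      (fun _ _ _ ↦ by ext; simp) (fun _ _ _ ↦ by ext; simp)
      (fun _ _ _ ↦ by ext; simp) (fun _ _ _ ↦ by ext; simp)) ‖B‖
    (fun A h ↦ by
      refine (ContinuousMap.norm_le _ (by positivity)).2 fun k ↦ ?_
      exact B.le_of_opNorm₂_le_of_le le_rfl (A.norm_coe_le_norm k) (h.norm_coe_le_norm k))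

/-- Pointwise application of a continuous family of operators to a continuous map, as a continuous
bilinear map. -/
noncomputable def ContinuousMap.pointwiseApply (K : Type*) [TopologicalSpace K] [CompactSpace K]
    (E F : Type*) [NormedAddCommGroup E] [NormedSpace ℝ E]
    [NormedAddCommGroup F] [NormedSpace ℝ F] :
    C(K, E →L[ℝ] F) →L[ℝ] C(K, E) →L[ℝ] C(K, F) :=
  ContinuousMap.pointwiseBilin K (.id ℝ (E →L[ℝ] F))

/-- The range of `γ` is compact, so `fderiv ℝ f` varies by at most `c` within a distance `δ` of any
of its points, with the same `δ` throughout. The mean value inequality then bounds the remainder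
uniformly in `k`. -/
theorem ContinuousMap.hasFDerivAt_comp_left {f : E → F} (hf : ContDiff ℝ 1 f) (γ : C(K, E)) :
    HasFDerivAt (fun γ : C(K, E) ↦ (⟨f, hf.continuous⟩ : C(E, F)).comp γ)
      (ContinuousMap.pointwiseApply K E F
        ((⟨fderiv ℝ f, hf.continuous_fderiv one_ne_zero⟩ : C(E, E →L[ℝ] F)).comp γ)) γ := by
  rw [hasFDerivAt_iff_isLittleO_nhds_zero, Asymptotics.isLittleO_iff]
  intro c hc
  have hcpt : IsCompact (range γ) := isCompact_range γ.continuous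
  have hunif := hcpt.uniformContinuousAt_of_continuousAt (fderiv ℝ f)
    (fun x _ ↦ (hf.continuous_fderiv one_ne_zero).continuousAt) (Metric.dist_mem_uniformity hc)
  obtain ⟨δ, hδ, hball⟩ := Metric.mem_uniformity_dist.1 hunif
  filter_upwards [Metric.ball_mem_nhds (0 : C(K, E)) hδ] with h hh
  rw [mem_ball_zero_iff] at hh
  refine (ContinuousMap.norm_le _ (by positivity)).2 fun k ↦ ?_
  have hk : ‖h k‖ < δ := (h.norm_coe_le_norm k).trans_lt hh
  have key := (convex_ball (γ k) δ).norm_image_sub_le_of_norm_fderiv_le' (𝕜 := ℝ) (f := f)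
    (φ := fderiv ℝ f (γ k)) (C := c) (x := γ k) (y := γ k + h k)
    (fun x _ ↦ (hf.differentiable one_ne_zero) x)
    (fun x hx ↦ by
      have := @hball (γ k) x (by rwa [dist_comm]) (mem_range_self k)
      rw [mem_ofPred_eq, dist_comm, dist_eq_norm] at this
      exact this.le)
    (Metric.mem_ball_self hδ) (by simpa [Metric.mem_ball, dist_eq_norm] using hk)
  refine le_trans ?_ (mul_le_mul_of_nonneg_left (h.norm_coe_le_norm k) hc.le)
  simp only [add_sub_cancel_left] at key
  exact key

-- Induction on `n`: the derivative of the composition operator of `f` is built from that of `fderiv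
-- ℝ f`. The target therefore changes to `E →L[ℝ] F`, which is why `F` is quantified inside and
-- shares the universe of `E`.
set_option synthInstance.maxHeartbeats 200000 in
theorem ContinuousMap.contDiff_comp_left_nat (n : ℕ) :
    ∀ (F : Type u) [NormedAddCommGroup F] [NormedSpace ℝ F] (f : C(E, F)), ContDiff ℝ n f →
      ContDiff ℝ n (fun γ : C(K, E) ↦ f.comp γ) := by
  induction n with
  | zero =>
    intro F _ _ f _
    exact contDiff_zero.2 (ContinuousMap.continuous_postcomp f)
  | succ n ih =>
    intro F _ _ f hf
    have h1 : ContDiff ℝ 1 f := hf.of_le (by norm_cast; omega)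
    push_cast at hf ⊢
    rw [contDiff_succ_iff_hasFDerivAt]
    refine ⟨_, ?_, fun γ ↦ ContinuousMap.hasFDerivAt_comp_left h1 γ⟩
    refine (ContinuousMap.pointwiseApply K E F).contDiff.comp (ih (E →L[ℝ] F) _ ?_)
    exact (contDiff_succ_iff_fderiv.1 hf).2.2

theorem ContinuousMap.contDiff_comp_left (f : C(E, F)) (hf : ContDiff ℝ ∞ f) :
    ContDiff ℝ ∞ (fun γ : C(K, E) ↦ f.comp γ) :=
  contDiff_infty.2 fun n ↦ ContinuousMap.contDiff_comp_left_nat n F f (contDiff_infty.1 hf n)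

end CompositionOperator

/-! ### Smooth dependence of the solutions of an autonomous equation on the initial value -/

section SmoothDependence

open Filter MeasureTheory

variable {E : Type*} [NormedAddCommGroup E] [NormedSpace ℝ E]

/-- The primitive, vanishing at `0`, of a continuous function on `[-1, 1]`. -/
noncomputable def primitiveCLM (E : Type*) [NormedAddCommGroup E] [NormedSpace ℝ E] :
    C(Icc (-1 : ℝ) 1, E) →L[ℝ] C(Icc (-1 : ℝ) 1, E) :=
  LinearMap.mkContinuous
    { toFun := fun γ ↦ ⟨fun t ↦ ∫ τ in (0 : ℝ)..t, γ (projIcc (-1) 1 (by norm_num) τ), by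
        have : Continuous (fun τ ↦ γ (projIcc (-1 : ℝ) 1 (by norm_num) τ)) := by fun_prop
        exact (intervalIntegral.continuous_primitive (fun _ _ ↦ this.intervalIntegrable _ _) 0).comp
          continuous_subtype_val⟩
      map_add' := fun γ γ' ↦ by
        ext t
        have h (γ : C(Icc (-1 : ℝ) 1, E)) :
          Continuous (fun τ ↦ γ (projIcc (-1 : ℝ) 1 (by norm_num) τ)) := by fun_prop
        exact intervalIntegral.integral_add ((h γ).intervalIntegrable _ _)
          ((h γ').intervalIntegrable _ _)
      map_smul' := fun c γ ↦ by
        ext t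
        exact intervalIntegral.integral_smul c _ } 1
    (fun γ ↦ by
      refine (ContinuousMap.norm_le _ (by positivity)).2 fun t ↦ ?_
      refine (intervalIntegral.norm_integral_le_of_norm_le_const
        (C := ‖γ‖) fun τ _ ↦ γ.norm_coe_le_norm _).trans ?_
      rw [mul_comm]
      gcongr
      simpa using abs_le.2 t.2)

/-- The solutions of the equations `Γ' = s • f Γ` on `(-1, 1)` depend smoothly on the initial value
`x` and on `s`. -/
theorem exists_contDiffAt_solution [CompleteSpace E] {f : E → E} (hf : ContDiff ℝ ∞ f) (x₀ : E)
    {U : Set E} (hU : U ∈ 𝓝 x₀) :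
    ∃ Ψ : ℝ × E → ℝ → E, (∀ t ∈ Icc (-1 : ℝ) 1, ContDiffAt ℝ ∞ (fun z ↦ Ψ z t) (0, x₀)) ∧
      ∀ᶠ z in 𝓝 ((0 : ℝ), x₀), Ψ z 0 = z.2 ∧ ∀ t ∈ Ioo (-1 : ℝ) 1, Ψ z t ∈ U ∧
        HasDerivAt (Ψ z) (z.1 • f (Ψ z t)) t := by
  let K := Icc (-1 : ℝ) 1
  let fc : C(E, E) := ⟨f, hf.continuous⟩
  let cst : E →L[ℝ] C(K, E) := ContinuousLinearMap.const ℝ K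
  -- Zeros of `G` are the solutions of the integral equation with initial value `z.1.2` and speed
  -- `z.1.1`.
  let G : (ℝ × E) × C(K, E) → C(K, E) := fun z ↦
    z.2 - cst z.1.2 - z.1.1 • primitiveCLM E (fc.comp z.2)
  let u : (ℝ × E) × C(K, E) := ((0, x₀), cst x₀)
  have hN : ContDiff ℝ ∞ (fun z : (ℝ × E) × C(K, E) ↦ fc.comp z.2) :=
    (ContinuousMap.contDiff_comp_left fc hf).comp contDiff_snd
  have hG : ContDiff ℝ ∞ G := by
    refine (contDiff_snd.sub (cst.contDiff.comp (contDiff_snd.comp contDiff_fst))).sub ?_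
    exact (contDiff_fst.comp contDiff_fst).smul ((primitiveCLM E).contDiff.comp hN)
  have hGu : G u = 0 := by simp [G, u]
  -- At `s = 0` the integral term vanishes identically in `γ`, leaving `γ ↦ γ - cst x₀`.
  have hder : fderiv ℝ G u ∘L .inr ℝ (ℝ × E) C(K, E) = .id ℝ _ := by
    have h1 : HasFDerivAt G (fderiv ℝ G u) (u.1, u.2) :=
      ((hG.differentiable (by simp)) u).hasFDerivAt
    have h2 := h1.comp u.2 (hasFDerivAt_prodMk_right u.1 u.2)
    refine h2.unique ?_
    have : (G ∘ fun γ ↦ (u.1, γ)) = fun γ ↦ γ - cst x₀ := by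
      ext1 γ; simp [G, u]
    rw [this]
    exact (hasFDerivAt_id _).sub_const _
  have hinv : (fderiv ℝ G u ∘L .inr ℝ (ℝ × E) C(K, E)).IsInvertible := by
    rw [hder]; exact ContinuousLinearMap.isInvertible_equiv (f := .refl ℝ _)
  have hGat : ContDiffAt ℝ ∞ G u := hG.contDiffAt
  let ψ := hGat.implicitFunction (by simp) hinv
  have hψ : ContDiffAt ℝ ∞ ψ (0, x₀) := hGat.contDiffAt_implicitFunction (by simp) hinv
  have hψ0 : ψ (0, x₀) = cst x₀ := hGat.implicitFunction_apply_self (by simp) hinv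
  have hψG : ∀ᶠ z in 𝓝 ((0 : ℝ), x₀), G (z, ψ z) = G u :=
    hGat.eventually_apply_implicitFunction (by simp) hinv
  have hψU : ∀ᶠ z in 𝓝 ((0 : ℝ), x₀), ∀ t, ψ z t ∈ U := by
    obtain ⟨ε, hε, hb⟩ := Metric.mem_nhds_iff.1 hU
    have := hψ.continuousAt.eventually (Metric.ball_mem_nhds _ hε)
    filter_upwards [this] with z hz t
    rw [hψ0] at hz
    exact hb (lt_of_le_of_lt (ContinuousMap.dist_apply_le_dist (f := ψ z) (g := cst x₀) t) hz)
  have h11 : (-1 : ℝ) ≤ 1 := by norm_num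
  -- The right-hand side of the integral equation replaces `ψ z` itself: it is defined for every
  -- real `t`, starts exactly at `z.2`, and is differentiated by the fundamental theorem of
  -- calculus.
  let Ψ : ℝ × E → ℝ → E := fun z t ↦
    z.2 + z.1 • ∫ τ in (0 : ℝ)..t, f (ψ z (projIcc (-1) 1 h11 τ))
  have hΨψ : ∀ᶠ z in 𝓝 ((0 : ℝ), x₀), ∀ t (ht : t ∈ K), Ψ z t = ψ z ⟨t, ht⟩ := by
    filter_upwards [hψG] with z hz t ht
    rw [hGu] at hz
    have := congrArg (fun γ : C(K, E) ↦ γ ⟨t, ht⟩) hz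
    simp only [G, ContinuousMap.sub_apply, ContinuousMap.zero_apply,
      ContinuousMap.smul_apply] at this
    rw [sub_sub, sub_eq_zero] at this
    exact this.symm
  refine ⟨Ψ, fun t ht ↦ ?_, ?_⟩
  · have h1 : ContDiffAt ℝ ∞ (fun z ↦ ContinuousMap.evalCLM ℝ (⟨t, ht⟩ : K) (ψ z)) (0, x₀) :=
      (ContinuousLinearMap.contDiff _).contDiffAt.comp _ hψ
    refine h1.congr_of_eventuallyEq ?_
    filter_upwards [hΨψ] with z hz using hz t ht
  · filter_upwards [hΨψ, hψU] with z hz hzU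
    refine ⟨by simp [Ψ], fun t ht ↦ ?_⟩
    have htK : t ∈ K := Ioo_subset_Icc_self ht
    refine ⟨by rw [hz t htK]; exact hzU _, ?_⟩
    have hc : Continuous (fun τ ↦ f (ψ z (projIcc (-1) 1 h11 τ))) :=
      hf.continuous.comp ((ψ z).continuous.comp continuous_projIcc)
    have h1 := ((hc.integral_hasStrictDerivAt 0 t).hasDerivAt.const_smul z.1).const_add z.2
    rw [projIcc_of_mem h11 htK, ← hz t htK] at h1
    exact h1

end SmoothDependence

/-! ### Smoothness of the flow of a complete vector field -/

section FlowSmooth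

open Filter

/-- A function that is smooth on a neighbourhood of a point agrees near this point with a function
that is smooth everywhere. -/
theorem ContDiffOn.exists_contDiff_eventuallyEq {E F : Type*} [NormedAddCommGroup E]
    [NormedSpace ℝ E] [FiniteDimensional ℝ E] [NormedAddCommGroup F] [NormedSpace ℝ F]
    {f : E → F} {U : Set E} (hf : ContDiffOn ℝ ∞ f U) {x : E} (hU : U ∈ 𝓝 x) :
    ∃ g : E → F, ContDiff ℝ ∞ g ∧ g =ᶠ[𝓝 x] f := by
  obtain ⟨V, hVU, hV, hxV⟩ := mem_nhds_iff.1 hU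
  obtain ⟨ε, hε, hball⟩ := Metric.nhds_basis_closedBall.mem_iff.1 (hV.mem_nhds hxV)
  let b : ContDiffBump x := ⟨ε / 2, ε, by positivity, by linarith⟩
  refine ⟨fun y ↦ b y • f y, ?_, ?_⟩
  · rw [contDiff_iff_contDiffAt]
    intro y
    by_cases hy : y ∈ V
    · exact b.contDiffAt.smul (hf.contDiffAt (mem_of_superset (hV.mem_nhds hy) hVU))
    · have hy' : y ∉ tsupport b := by
        rw [b.tsupport_eq]
        exact fun h ↦ hy (hball h)
      refine contDiffAt_const (c := (0 : F)) |>.congr_of_eventuallyEq ?_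
      filter_upwards [(isClosed_tsupport b).isOpen_compl.mem_nhds hy'] with z hz
      rw [image_eq_zero_of_notMem_tsupport hz, zero_smul]
  · filter_upwards [b.eventuallyEq_one] with y hy
    rw [hy, Pi.one_apply, one_smul]

variable {E : Type*} [NormedAddCommGroup E] [NormedSpace ℝ E]
  {M : Type*} [TopologicalSpace M] [ChartedSpace E M] [IsManifold 𝓘(ℝ, E) ∞ M]

/-- The derivative at `q` of the preferred chart at `x₀`, as an operator of the model space. -/
noncomputable def chartDeriv (x₀ q : M) : E →L[ℝ] E :=
  mfderiv 𝓘(ℝ, E) 𝓘(ℝ, E) (extChartAt 𝓘(ℝ, E) x₀) q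

/-- The derivative at `y` of the inverse of the preferred chart at `x₀`, as an operator of the model
space. -/
noncomputable def chartSymmDeriv (x₀ : M) (y : E) : E →L[ℝ] E :=
  mfderiv 𝓘(ℝ, E) 𝓘(ℝ, E) (extChartAt 𝓘(ℝ, E) x₀).symm y

theorem chartDeriv_comp_chartSymmDeriv {x₀ : M} {y : E}
    (hy : y ∈ (extChartAt 𝓘(ℝ, E) x₀).target) :
    (chartDeriv x₀ ((extChartAt 𝓘(ℝ, E) x₀).symm y)).comp (chartSymmDeriv x₀ y) = .id ℝ E := by
  have h := mfderiv_extChartAt_comp_mfderivWithin_extChartAt_symm hy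
  simp only [modelWithCornersSelf_coe, range_id, mfderivWithin_univ] at h
  exact h

theorem chartSymmDeriv_comp_chartDeriv {x₀ : M} {y : E}
    (hy : y ∈ (extChartAt 𝓘(ℝ, E) x₀).target) :
    (chartSymmDeriv x₀ y).comp (chartDeriv x₀ ((extChartAt 𝓘(ℝ, E) x₀).symm y)) = .id ℝ E := by
  have h := mfderivWithin_extChartAt_symm_comp_mfderiv_extChartAt hy
  simp only [modelWithCornersSelf_coe, range_id, mfderivWithin_univ] at h
  exact h

/-- The expression of a vector field in the preferred chart at `x₀`. -/
noncomputable def vectorFieldInChart (X : (q : M) → TangentSpace 𝓘(ℝ, E) q) (x₀ : M) : E → E :=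
  fun y ↦ chartDeriv x₀ ((extChartAt 𝓘(ℝ, E) x₀).symm y)
    (show E from X ((extChartAt 𝓘(ℝ, E) x₀).symm y))

/-- The trivialization of the tangent bundle at `x₀` acts on fibres as the derivative of the chart,
so the local expression is the trivialized section composed with the inverse chart. -/
theorem IsSmoothVectorField.contDiffOn_inChart {X : (q : M) → TangentSpace 𝓘(ℝ, E) q}
    (hXs : IsSmoothVectorField 𝓘(ℝ, E) X) (x₀ : M) :
    ContDiffOn ℝ ∞ (vectorFieldInChart X x₀) (extChartAt 𝓘(ℝ, E) x₀).target := by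
  have h1 : ContMDiffOn 𝓘(ℝ, E) 𝓘(ℝ, E) ∞
      (fun q ↦ (trivializationAt E (TangentSpace 𝓘(ℝ, E)) x₀ ⟨q, X q⟩).2)
      (trivializationAt E (TangentSpace 𝓘(ℝ, E)) x₀).baseSet :=
    (Trivialization.contMDiffOn_section_baseSet_iff _).1 (ContMDiff.contMDiffOn hXs)
  have h2 := h1.comp (contMDiffOn_extChartAt_symm (I := 𝓘(ℝ, E)) (n := ∞) x₀)
    (fun y hy ↦ by simpa using (extChartAt 𝓘(ℝ, E) x₀).map_target hy)
  refine (contMDiffOn_iff_contDiffOn.1 h2).congr fun y hy ↦ ?_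
  have hy' : (extChartAt 𝓘(ℝ, E) x₀).symm y ∈ (chartAt E x₀).source := by
    simpa using (extChartAt 𝓘(ℝ, E) x₀).map_target hy
  have h3 := congr($(TangentBundle.continuousLinearMapAt_trivializationAt (I := 𝓘(ℝ, E)) hy')
    (X ((extChartAt 𝓘(ℝ, E) x₀).symm y)))
  refine h3.symm.trans ?_
  exact congrFun (Trivialization.coe_linearMapAt_of_mem
    (trivializationAt E (TangentSpace 𝓘(ℝ, E)) x₀) (by simpa using! hy')) _

theorem hasMFDerivAt_extChartAt_symm_comp {X : (q : M) → TangentSpace 𝓘(ℝ, E) q} {x₀ : M}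
    {Γ : ℝ → E} {t : ℝ} (hΓ : HasDerivAt Γ (vectorFieldInChart X x₀ (Γ t)) t)
    (ht : Γ t ∈ (extChartAt 𝓘(ℝ, E) x₀).target) :
    HasMFDerivAt 𝓘(ℝ, ℝ) 𝓘(ℝ, E) ((extChartAt 𝓘(ℝ, E) x₀).symm ∘ Γ) t
      ((1 : ℝ →L[ℝ] ℝ).smulRight (X ((extChartAt 𝓘(ℝ, E) x₀).symm (Γ t)))) := by
  have h1 : MDifferentiableAt 𝓘(ℝ, E) 𝓘(ℝ, E) (extChartAt 𝓘(ℝ, E) x₀).symm (Γ t) := by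
    have := mdifferentiableWithinAt_extChartAt_symm ht
    rwa [modelWithCornersSelf_coe, range_id, mdifferentiableWithinAt_univ] at this
  have h2 := h1.hasMFDerivAt.comp t hΓ.hasFDerivAt.hasMFDerivAt
  refine h2.congr_mfderiv ?_
  ext
  have h3 := congr($(chartSymmDeriv_comp_chartDeriv ht)
    (show E from X ((extChartAt 𝓘(ℝ, E) x₀).symm (Γ t))))
  change chartSymmDeriv x₀ (Γ t) ((1 : ℝ) • vectorFieldInChart X x₀ (Γ t)) =
    (1 : ℝ) • (show E from X ((extChartAt 𝓘(ℝ, E) x₀).symm (Γ t)))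
  rw [one_smul, one_smul]
  exact h3

variable [FiniteDimensional ℝ E] [T2Space M]

/-- Here the local field is cut off to a smooth field on all of `E`, solved there, and identified
with the flow by uniqueness of integral curves. -/
theorem contMDiffAt_flowOf_zero {X : (q : M) → TangentSpace 𝓘(ℝ, E) q}
    (hXs : IsSmoothVectorField 𝓘(ℝ, E) X) (hX : IsCompleteVectorField 𝓘(ℝ, E) X) (x₀ : M) :
    ContMDiffAt (𝓘(ℝ, ℝ).prod 𝓘(ℝ, E)) 𝓘(ℝ, E) ∞
      (fun z : ℝ × M ↦ flowOf 𝓘(ℝ, E) X hX z.1 z.2) (0, x₀) := by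
  have : CompleteSpace E := FiniteDimensional.complete ℝ E
  set c := extChartAt 𝓘(ℝ, E) x₀ with hc
  obtain ⟨f, hf, hfX⟩ := (hXs.contDiffOn_inChart x₀).exists_contDiff_eventuallyEq
    (extChartAt_target_mem_nhds x₀)
  obtain ⟨Ψ, hΨ, hsol⟩ := exists_contDiffAt_solution hf (c x₀)
    (hfX.and (extChartAt_target_mem_nhds x₀))
  -- The solution with speed `2t` at time `1/2` is the flow at time `t`. The endpoint `1` is
  -- unavailable, since the equation is only known on the open interval `(-1, 1)`.
  let z₀ : ℝ × M → ℝ × E := fun z ↦ (2 * z.1, c z.2)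
  have hz₀ : ContMDiffAt (𝓘(ℝ, ℝ).prod 𝓘(ℝ, E)) 𝓘(ℝ, ℝ × E) ∞ z₀ (0, x₀) := by
    refine ContMDiffAt.prodMk_space ?_ ?_
    · exact (contDiff_const.mul contDiff_id : ContDiff ℝ ∞ (fun t : ℝ ↦ 2 * t)).contMDiff.contMDiffAt.comp
        (0, x₀) contMDiffAt_fst
    · exact (contMDiffAt_extChartAt (I := 𝓘(ℝ, E))).comp (0, x₀) contMDiffAt_snd
  have hz₀0 : z₀ (0, x₀) = (0, c x₀) := by simp [z₀]
  have hh : (1 / 2 : ℝ) ∈ Ioo (-1 : ℝ) 1 := by constructor <;> norm_num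
  have hh0 : (0 : ℝ) ∈ Ioo (-1 : ℝ) 1 := by constructor <;> norm_num
  have hsol' : ∀ᶠ z in 𝓝 ((0 : ℝ), x₀), flowOf 𝓘(ℝ, E) X hX z.1 z.2 =
      c.symm (Ψ (z₀ z) (1 / 2)) := by
    have hev := hz₀.continuousAt.eventually (hz₀0 ▸ hsol)
    have hsrc : ∀ᶠ z : ℝ × M in 𝓝 ((0 : ℝ), x₀), z.2 ∈ c.source :=
      continuousAt_snd.eventually (extChartAt_source_mem_nhds x₀)
    filter_upwards [hev, hsrc] with z hz hzs
    obtain ⟨hz1, hz2⟩ := hz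
    have hsX : IsSmoothVectorField 𝓘(ℝ, E) ((2 * z.1) • X) := by
      exact ContMDiff.const_smul_section (a := 2 * z.1) hXs
    have e1 := (isMIntegralCurve_flowOf hX z.2).comp_mul (2 * z.1)
    have e2 : IsMIntegralCurveOn (I := 𝓘(ℝ, E)) (c.symm ∘ Ψ (z₀ z)) ((2 * z.1) • X)
        (Ioo (-1 : ℝ) 1) := by
      intro t ht
      obtain ⟨⟨h1, h2⟩, h3⟩ := hz2 t ht
      refine (hasMFDerivAt_extChartAt_symm_comp (X := (2 * z.1) • X) ?_ h2).hasMFDerivWithinAt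
      convert! h3 using 1
      rw [h1]
      exact map_smul (chartDeriv x₀ (c.symm (Ψ (z₀ z) t))) (2 * z.1) _
    have := isMIntegralCurveOn_Ioo_eqOn_of_contMDiff_boundaryless hh0
      (ContMDiff.of_le hsX (by simp)) (e1.isMIntegralCurveOn _) e2
      (by simp [hz1, flowOf_zero, z₀, c.left_inv hzs]) hh
    simpa using this
  refine ContMDiffAt.congr_of_eventuallyEq ?_ hsol'
  have h1 : ContMDiffAt (𝓘(ℝ, ℝ).prod 𝓘(ℝ, E)) 𝓘(ℝ, E) ∞ (fun z ↦ Ψ (z₀ z) (1 / 2)) (0, x₀) := by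
    refine ContMDiffAt.comp (I' := 𝓘(ℝ, ℝ × E)) (g := fun z ↦ Ψ z (1 / 2)) (0, x₀) ?_ hz₀
    rw [hz₀0]
    exact (hΨ _ (Ioo_subset_Icc_self hh)).contMDiffAt
  have h2 : Ψ (z₀ (0, x₀)) (1 / 2) ∈ c.target := by
    rw [hz₀0]
    exact (hsol.self_of_nhds.2 _ hh).1.2
  exact ((contMDiffOn_extChartAt_symm x₀).contMDiffAt
    ((isOpen_extChartAt_target x₀).mem_nhds h2)).comp (0, x₀) h1

/-- The flow of a smooth complete vector field is smooth. -/
theorem isSmoothGlobalFlow_flowOf {X : (q : M) → TangentSpace 𝓘(ℝ, E) q}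
    (hXs : IsSmoothVectorField 𝓘(ℝ, E) X) (hX : IsCompleteVectorField 𝓘(ℝ, E) X) :
    IsSmoothGlobalFlow 𝓘(ℝ, E) (flowOf 𝓘(ℝ, E) X hX) := by
  -- Finite `n` is needed: being `C^n` at a point then passes to a neighbourhood, which fails for
  -- `∞`.
  refine ⟨contMDiff_infty.2 fun n ⟨t, x⟩ ↦ ?_, flowOf_zero hX, flowOf_add hXs hX⟩
  set φ := flowOf 𝓘(ℝ, E) X hX
  -- The times near which the flow is `C^n` around `x`; this set is shown to be clopen and to
  -- contain `0`.
  let A : Set ℝ := {t | ∀ᶠ z in 𝓝 (t, x), ContMDiffAt (𝓘(ℝ, ℝ).prod 𝓘(ℝ, E)) 𝓘(ℝ, E) n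
    (fun z : ℝ × M ↦ φ z.1 z.2) z}
  have hlocal (y : M) : ∀ᶠ z in 𝓝 ((0 : ℝ), y), ContMDiffAt (𝓘(ℝ, ℝ).prod 𝓘(ℝ, E)) 𝓘(ℝ, E) n
      (fun z : ℝ × M ↦ φ z.1 z.2) z :=
    (contMDiffAt_iff_contMDiffAt_nhds (by simp)).1
      (contMDiffAt_infty.1 (contMDiffAt_flowOf_zero hXs hX y) n)
  suffices hA : A = univ from (hA ▸ mem_univ t : t ∈ A).self_of_nhds
  refine IsClopen.eq_univ ⟨?_, ?_⟩ ⟨0, hlocal x⟩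
  · refine isClosed_of_closure_subset fun t ht ↦ ?_
    let y := φ t x
    obtain ⟨u, hu, v, hv, huv⟩ := mem_nhds_prod_iff.1 (hlocal y)
    have hγ : Continuous (fun s ↦ φ s x) := (isMIntegralCurve_flowOf hX x).continuous
    have hev : ∀ᶠ s in 𝓝 t, t - s ∈ interior u ∧ φ s x ∈ interior v := by
      refine Filter.Eventually.and ?_ (hγ.continuousAt.eventually (interior_mem_nhds.2 hv))
      have : ContinuousAt (fun s ↦ t - s) t := by fun_prop
      exact this.eventually (by simpa using interior_mem_nhds.2 hu)
    obtain ⟨s, hsA, hsu, hsv⟩ := (mem_closure_iff_frequently.1 ht).and_eventually hev |>.exists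
    have hs : ∀ᶠ z : ℝ × M in 𝓝 (t, x), ContMDiffAt 𝓘(ℝ, E) 𝓘(ℝ, E) n (φ s) z.2 := by
      have h1 : ∀ᶠ q in 𝓝 x, ContMDiffAt (𝓘(ℝ, ℝ).prod 𝓘(ℝ, E)) 𝓘(ℝ, E) n
          (fun z : ℝ × M ↦ φ z.1 z.2) (s, q) :=
        (Continuous.prodMk_right s).continuousAt.eventually hsA
      have h2 : ∀ᶠ q in 𝓝 x, ContMDiffAt 𝓘(ℝ, E) 𝓘(ℝ, E) n (φ s) q :=
        h1.mono fun q hq ↦ hq.comp q (contMDiffAt_const.prodMk contMDiffAt_id)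
      exact continuousAt_snd.eventually h2
    have hsv' : ∀ᶠ z : ℝ × M in 𝓝 (t, x), φ s z.2 ∈ interior v := by
      have := hs.self_of_nhds.continuousAt.eventually (isOpen_interior.mem_nhds hsv)
      exact continuousAt_snd.eventually this
    have hsu' : ∀ᶠ z : ℝ × M in 𝓝 (t, x), z.1 - s ∈ interior u := by
      have : ContinuousAt (fun z : ℝ × M ↦ z.1 - s) (t, x) := by fun_prop
      exact this.eventually (isOpen_interior.mem_nhds hsu)
    filter_upwards [hs, hsv', hsu'] with z h1 h2 h3
    -- The group law factors the flow through a time `s ∈ A` close to `t`: the map `φ s` is `C^n`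
    -- near `x`, and the remaining short time is covered by `hlocal` at `φ t x`.
    have heq : (fun z : ℝ × M ↦ φ z.1 z.2) =
        (fun z : ℝ × M ↦ φ z.1 z.2) ∘ (fun z ↦ (z.1 - s, φ s z.2)) := by
      ext1 w
      simp only [comp_apply, φ, flowOf_add hXs hX, sub_add_cancel]
    rw [heq]
    refine ContMDiffAt.comp z (huv (mk_mem_prod (interior_subset h3) (interior_subset h2))) ?_
    refine ContMDiffAt.prodMk ?_ (h1.comp z contMDiffAt_snd)
    exact contMDiffAt_fst.sub contMDiffAt_const
  · rw [isOpen_iff_eventually]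
    intro t ht
    have : ContinuousAt (fun s : ℝ ↦ (s, x)) t := by fun_prop
    exact this.eventually ht.eventually_nhds

end FlowSmooth

/-! ### The infinitesimal generator of a smooth global flow -/

section Generator

variable {E : Type*} [NormedAddCommGroup E] [NormedSpace ℝ E]
  {H : Type*} [TopologicalSpace H] (I : ModelWithCorners ℝ E H)
  {N : Type*} [TopologicalSpace N] [ChartedSpace H N]

/-- The velocity at time `0` of the curves `t ↦ φ t p`. -/
noncomputable def flowGenerator (φ : ℝ → N → N) (p : N) : TangentSpace I p :=
  show TangentSpace I p from mfderiv 𝓘(ℝ, ℝ) I (fun t : ℝ ↦ φ t p) 0 (1 : ℝ)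

variable {I} {φ : ℝ → N → N}

theorem IsSmoothGlobalFlow.mdifferentiableAt_curve (hφ : IsSmoothGlobalFlow I φ) (p : N) (t : ℝ) :
    MDifferentiableAt 𝓘(ℝ, ℝ) I (fun t : ℝ ↦ φ t p) t :=
  (hφ.smooth.comp (contMDiff_id.prodMk contMDiff_const)).mdifferentiableAt (by simp)

theorem IsSmoothGlobalFlow.hasMFDerivAt_curve_zero (hφ : IsSmoothGlobalFlow I φ) (p : N) :
    HasMFDerivAt 𝓘(ℝ, ℝ) I (fun t : ℝ ↦ φ t p) 0
      ((1 : ℝ →L[ℝ] ℝ).smulRight (show E from flowGenerator I φ p)) := by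
  refine (hφ.mdifferentiableAt_curve p 0).hasMFDerivAt.congr_mfderiv ?_
  ext
  exact (one_smul ℝ (show E from flowGenerator I φ p)).symm

/-- Since `φ s p = φ (s - t) (φ t p)`, the velocity at time `t` is the velocity at time `0` of the
orbit of `φ t p`. -/
theorem IsSmoothGlobalFlow.isMIntegralCurve (hφ : IsSmoothGlobalFlow I φ) (p : N) :
    IsMIntegralCurve (I := I) (fun t ↦ φ t p) (flowGenerator I φ) := by
  intro t
  have h1 := hφ.hasMFDerivAt_curve_zero (φ t p)
  have h2 : HasMFDerivAt 𝓘(ℝ, ℝ) 𝓘(ℝ, ℝ) (fun s : ℝ ↦ s - t) t (.id ℝ ℝ) :=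
    ((hasFDerivAt_id t).sub_const t).hasMFDerivAt
  rw [← sub_self t] at h1
  have h3 := HasMFDerivAt.comp (g := fun s ↦ φ s (φ t p)) (f := fun s ↦ s - t) t h1 h2
  have h4 : (fun s ↦ φ s (φ t p)) ∘ (fun s ↦ s - t) = fun s ↦ φ s p := by
    ext1 s
    simp [hφ.add]
  rw [h4] at h3
  exact h3

theorem IsSmoothGlobalFlow.isCompleteVectorField_generator (hφ : IsSmoothGlobalFlow I φ) :
    IsCompleteVectorField I (flowGenerator I φ) :=
  fun p ↦ ⟨fun t ↦ φ t p, hφ.zero p, hφ.isMIntegralCurve p⟩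

/-- The generator is the tangent map of `(t, p) ↦ φ t p` applied to the smooth family of vectors at
`(0, p)` with time component `1` and space component `0`. -/
theorem IsSmoothGlobalFlow.isSmoothVectorField_generator [IsManifold I ∞ N]
    (hφ : IsSmoothGlobalFlow I φ) :
    IsSmoothVectorField I (flowGenerator I φ) := by
  let Φ : ℝ × N → N := fun z ↦ φ z.1 z.2
  have hT : ContMDiff (𝓘(ℝ, ℝ).prod I).tangent I.tangent ∞
      (tangentMap (𝓘(ℝ, ℝ).prod I) I Φ) := hφ.smooth.contMDiff_tangentMap (by simp)
  have hS : ContMDiff I (𝓘(ℝ, ℝ).tangent.prod I.tangent) ∞ (fun p : N ↦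
      ((⟨0, (1 : ℝ)⟩, ⟨p, 0⟩) : TangentBundle 𝓘(ℝ, ℝ) ℝ × TangentBundle I N)) :=
    contMDiff_const.prodMk (contMDiff_zeroSection ℝ (TangentSpace I : N → Type _))
  have h := hT.comp ((contMDiff_equivTangentBundleProd_symm).comp hS)
  -- The tangent map lands over `φ 0 p`, which equals `p` only propositionally.
  have aux (a b : N) (hab : a = b) (v : E) :
      (⟨a, v⟩ : TangentBundle I N) = (⟨b, v⟩ : TangentBundle I N) := by subst hab; rfl
  refine h.congr fun p ↦ ?_
  refine (aux _ _ (hφ.zero p) (mfderiv 𝓘(ℝ, ℝ) I (fun t : ℝ ↦ φ t p) 0 (1 : ℝ))).symm.trans ?_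
  have h1 : HasMFDerivAt (𝓘(ℝ, ℝ).prod I) I Φ ((0 : ℝ), p) (mfderiv (𝓘(ℝ, ℝ).prod I) I Φ (0, p)) :=
    (hφ.smooth.mdifferentiableAt (by simp)).hasMFDerivAt
  have h2 : HasMFDerivAt 𝓘(ℝ, ℝ) (𝓘(ℝ, ℝ).prod I) (fun t : ℝ ↦ (t, p)) 0 _ :=
    (hasMFDerivAt_id (I := 𝓘(ℝ, ℝ)) (0 : ℝ)).prodMk (hasMFDerivAt_const (I := 𝓘(ℝ, ℝ)) p (0 : ℝ))
  have h3 := (HasMFDerivAt.comp (g := Φ) (f := fun t : ℝ ↦ (t, p)) 0 h1 h2).mfderiv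
  exact congrArg (TotalSpace.mk (φ 0 p)) congr($h3 (1 : ℝ))

theorem IsSmoothGlobalFlow.flowOf_generator [IsManifold I ∞ N] [T2Space N]
    [BoundarylessManifold I N] [CompleteSpace E] (hφ : IsSmoothGlobalFlow I φ)
    (h : IsCompleteVectorField I (flowGenerator I φ)) (t : ℝ) (p : N) :
    flowOf I (flowGenerator I φ) h t p = φ t p := by
  have := isMIntegralCurve_Ioo_eq_of_contMDiff_boundaryless (t₀ := (0 : ℝ))
    (ContMDiff.of_le hφ.isSmoothVectorField_generator (by simp)) (isMIntegralCurve_flowOf h p)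
    (hφ.isMIntegralCurve p) (by simp [flowOf_zero, hφ.zero])
  exact congrFun this t

end Generator

/-! ### Charts of the cotangent bundle -/

section CotangentCharts

variable {E : Type*} [NormedAddCommGroup E] [NormedSpace ℝ E]
  {M : Type*} [TopologicalSpace M] [ChartedSpace E M] [IsManifold 𝓘(ℝ, E) ∞ M]

theorem trivializationAt_continuousLinearMapAt_eq_chartDeriv {x₀ x : M}
    (hx : x ∈ (extChartAt 𝓘(ℝ, E) x₀).source) :
    (trivializationAt E (TangentSpace 𝓘(ℝ, E)) x₀).continuousLinearMapAt ℝ x =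
      chartDeriv (E := E) x₀ x :=
  TangentBundle.continuousLinearMapAt_trivializationAt (by simpa using hx)

theorem trivializationAt_symmL_eq_chartSymmDeriv {x₀ x : M}
    (hx : x ∈ (extChartAt 𝓘(ℝ, E) x₀).source) :
    (trivializationAt E (TangentSpace 𝓘(ℝ, E)) x₀).symmL ℝ x =
      chartSymmDeriv x₀ (extChartAt 𝓘(ℝ, E) x₀ x) := by
  have h := TangentBundle.symmL_trivializationAt (I := 𝓘(ℝ, E)) (𝕜 := ℝ) (x₀ := x₀) (x := x)
    (by simpa using hx)
  rw [modelWithCornersSelf_coe, range_id, mfderivWithin_univ] at h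
  exact h

/-- Translates the coordinates in which smoothness of a parametric derivative is stated into
explicit chart derivatives. -/
theorem inTangentCoordinates_eq_chartDeriv {N : Type*} {M' : Type*} [TopologicalSpace M']
    [ChartedSpace E M'] [IsManifold 𝓘(ℝ, E) ∞ M'] (f : N → M) (g : N → M') (ϕ : N → E →L[ℝ] E)
    {x₀ x : N} (hf : f x ∈ (extChartAt 𝓘(ℝ, E) (f x₀)).source)
    (hg : g x ∈ (extChartAt 𝓘(ℝ, E) (g x₀)).source) :
    inTangentCoordinates 𝓘(ℝ, E) 𝓘(ℝ, E) f g ϕ x₀ x =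
      (chartDeriv (g x₀) (g x)).comp
        ((ϕ x).comp (chartSymmDeriv (f x₀) (extChartAt 𝓘(ℝ, E) (f x₀) (f x)))) := by
  exact congrArg₂ (fun A B : E →L[ℝ] E ↦ A.comp ((ϕ x).comp B))
    (trivializationAt_continuousLinearMapAt_eq_chartDeriv hg)
    (trivializationAt_symmL_eq_chartSymmDeriv hf)

/-- The covector with base point `q` and value `ξ`. -/
def covector (q : M) (ξ : E →L[ℝ] ℝ) : CotangentBundle E M := ⟨q, ξ⟩

/-- The value of a covector, as a functional on the model space. -/
def covectorValue (p : CotangentBundle E M) : E →L[ℝ] ℝ := p.snd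

omit [IsManifold 𝓘(ℝ, E) ∞ M] in
@[simp]
theorem covector_proj (q : M) (ξ : E →L[ℝ] ℝ) : (covector q ξ).proj = q := rfl

omit [IsManifold 𝓘(ℝ, E) ∞ M] in
@[simp]
theorem covectorValue_covector (q : M) (ξ : E →L[ℝ] ℝ) :
    covectorValue (covector q ξ) = ξ := rfl

omit [IsManifold 𝓘(ℝ, E) ∞ M] in
theorem covector_ext {p p' : CotangentBundle E M} (h : p.proj = p'.proj)
    (h' : covectorValue p = covectorValue p') : p = p' := by
  obtain ⟨q, ξ⟩ := p
  obtain ⟨q', ξ'⟩ := p'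
  obtain rfl : q = q' := h
  exact congrArg (covector (E := E) q) h'

theorem mem_extChartAt_cotangent_source {p₀ p : CotangentBundle E M} :
    p ∈ (extChartAt (cotangentModel E) p₀).source ↔
      p.proj ∈ (extChartAt 𝓘(ℝ, E) p₀.proj).source := by
  rw [FiberBundle.extChartAt]
  simp only [PartialEquiv.trans_source, PartialEquiv.prod_source, PartialEquiv.refl_source,
    mem_inter_iff, mem_preimage, mem_prod, mem_univ, and_true, extChartAt_source]
  refine ⟨fun h ↦ by simpa using! h.1, fun h ↦ ?_⟩
  have hs : p ∈ (trivializationAt (E →L[ℝ] ℝ)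
      (fun x : M ↦ TangentSpace 𝓘(ℝ, E) x →L[ℝ] Trivial M ℝ x) p₀.proj).source := by simpa using! h
  exact ⟨hs, by simpa using! h⟩

theorem mem_extChartAt_cotangent_target {p₀ : CotangentBundle E M} {z : E × (E →L[ℝ] ℝ)} :
    z ∈ (extChartAt (cotangentModel E) p₀).target ↔
      z.1 ∈ (extChartAt 𝓘(ℝ, E) p₀.proj).target := by
  rw [FiberBundle.extChartAt_target]
  simp only [mem_prod, mem_inter_iff, mem_univ, and_true, mem_preimage, and_iff_left_iff_imp]
  intro hz
  simpa using (extChartAt 𝓘(ℝ, E) p₀.proj).map_target hz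

theorem inCoordinates_covector {q₀ q : M} (ξ : E →L[ℝ] ℝ)
    (hq : q ∈ (extChartAt 𝓘(ℝ, E) q₀).source) :
    ContinuousLinearMap.inCoordinates E (TangentSpace 𝓘(ℝ, E) : M → Type _) ℝ (Trivial M ℝ)
      q₀ q q₀ q ξ = ξ.comp (chartSymmDeriv q₀ (extChartAt 𝓘(ℝ, E) q₀ q)) := by
  rw [← trivializationAt_symmL_eq_chartSymmDeriv hq]
  ext v
  simp [ContinuousLinearMap.inCoordinates]
  rfl

theorem extChartAt_cotangent_apply {p₀ p : CotangentBundle E M}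
    (hp : p.proj ∈ (extChartAt 𝓘(ℝ, E) p₀.proj).source) :
    extChartAt (cotangentModel E) p₀ p = (extChartAt 𝓘(ℝ, E) p₀.proj p.proj,
      (covectorValue p).comp
        (chartSymmDeriv p₀.proj (extChartAt 𝓘(ℝ, E) p₀.proj p.proj))) := by
  rw [FiberBundle.extChartAt, ← inCoordinates_covector _ hp]
  rfl

/-- The proposed covector lies in the chart domain and is sent to `z`, because the two chart
derivatives cancel. -/
theorem extChartAt_cotangent_symm_apply {p₀ : CotangentBundle E M} {z : E × (E →L[ℝ] ℝ)}
    (hz : z.1 ∈ (extChartAt 𝓘(ℝ, E) p₀.proj).target) :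
    (extChartAt (cotangentModel E) p₀).symm z = covector ((extChartAt 𝓘(ℝ, E) p₀.proj).symm z.1)
      (z.2.comp (chartDeriv p₀.proj ((extChartAt 𝓘(ℝ, E) p₀.proj).symm z.1))) := by
  set p := covector ((extChartAt 𝓘(ℝ, E) p₀.proj).symm z.1)
      (z.2.comp (chartDeriv p₀.proj ((extChartAt 𝓘(ℝ, E) p₀.proj).symm z.1)))
  have hp : p.proj ∈ (extChartAt 𝓘(ℝ, E) p₀.proj).source :=
    (extChartAt 𝓘(ℝ, E) p₀.proj).map_target hz
  have h1 : extChartAt (cotangentModel E) p₀ p = z := by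
    rw [extChartAt_cotangent_apply hp]
    refine Prod.ext ?_ ?_
    · exact (extChartAt 𝓘(ℝ, E) p₀.proj).right_inv hz
    · simp only [p, covectorValue_covector, covector_proj]
      rw [(extChartAt 𝓘(ℝ, E) p₀.proj).right_inv hz, ContinuousLinearMap.comp_assoc,
        chartDeriv_comp_chartSymmDeriv hz, ContinuousLinearMap.comp_id]
  rw [← h1, (extChartAt (cotangentModel E) p₀).left_inv (mem_extChartAt_cotangent_source.2 hp)]

/-- Smoothness of a map into the cotangent bundle, in terms of its base point and its fibre
coordinate. -/
theorem contMDiffAt_cotangent_iff {E' : Type*} [NormedAddCommGroup E'] [NormedSpace ℝ E']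
    {H' : Type*} [TopologicalSpace H'] {J : ModelWithCorners ℝ E' H'} {N : Type*}
    [TopologicalSpace N] [ChartedSpace H' N] {f : N → CotangentBundle E M} {x₀ : N} :
    ContMDiffAt J (cotangentModel E) ∞ f x₀ ↔
      ContMDiffAt J 𝓘(ℝ, E) ∞ (fun x ↦ (f x).proj) x₀ ∧
      ContMDiffAt J 𝓘(ℝ, E →L[ℝ] ℝ) ∞ (fun x ↦ (covectorValue (f x)).comp (chartSymmDeriv (f x₀).proj
        (extChartAt 𝓘(ℝ, E) (f x₀).proj (f x).proj))) x₀ := by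
  rw [contMDiffAt_hom_bundle]
  refine and_congr_right fun h ↦ Filter.EventuallyEq.contMDiffAt_iff ?_
  filter_upwards [h.continuousAt.eventually (extChartAt_source_mem_nhds (I := 𝓘(ℝ, E)) (f x₀).proj)]
    with x hx
  exact inCoordinates_covector _ hx

/-- Needed for uniqueness of integral curves on `T*M`. Covectors over different points are separated
by the projection, those over the same point by a trivialization. -/
instance [T2Space M] : T2Space (CotangentBundle E M) := by
  refine ⟨fun p p' hne ↦ ?_⟩
  have hcont : Continuous (fun p : CotangentBundle E M ↦ p.proj) :=
    FiberBundle.continuous_proj (E →L[ℝ] ℝ) _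
  by_cases hproj : p.proj = p'.proj
  · let e := trivializationAt (E →L[ℝ] ℝ)
      (fun x : M ↦ TangentSpace 𝓘(ℝ, E) x →L[ℝ] Trivial M ℝ x) p.proj
    have hp : p ∈ e.source := by simp [e]
    have hp' : p' ∈ e.source := by simp [e, ← hproj]
    obtain ⟨u, v, hu, hv, hpu, hpv, huv⟩ := t2_separation (e.injOn.ne hp hp' hne)
    refine ⟨_, _, e.continuousOn_toFun.isOpen_inter_preimage e.open_source hu,
      e.continuousOn_toFun.isOpen_inter_preimage e.open_source hv, ⟨hp, hpu⟩, ⟨hp', hpv⟩, ?_⟩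
    exact (huv.preimage e).mono inter_subset_right inter_subset_right
  · obtain ⟨u, v, hu, hv, hpu, hpv, huv⟩ := t2_separation hproj
    exact ⟨_, _, hu.preimage hcont, hv.preimage hcont, hpu, hpv, huv.preimage _⟩

end CotangentCharts

/-! ### The lift of a smooth global flow to the cotangent bundle -/

section LiftFlow

variable {E : Type*} [NormedAddCommGroup E] [NormedSpace ℝ E]
  {M : Type*} [TopologicalSpace M] [ChartedSpace E M] [IsManifold 𝓘(ℝ, E) ∞ M]

/-- The derivative at `q` of the time-`t` map of a flow, as an operator of the model space. -/
noncomputable def flowDeriv (φ : ℝ → M → M) (t : ℝ) (q : M) : E →L[ℝ] E :=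
  mfderiv 𝓘(ℝ, E) 𝓘(ℝ, E) (φ t) q

omit [IsManifold 𝓘(ℝ, E) ∞ M] in
theorem IsSmoothGlobalFlow.contMDiff_map {φ : ℝ → M → M} (hφ : IsSmoothGlobalFlow 𝓘(ℝ, E) φ)
    (t : ℝ) : ContMDiff 𝓘(ℝ, E) 𝓘(ℝ, E) ∞ (φ t) :=
  hφ.smooth.comp (contMDiff_const.prodMk contMDiff_id)

omit [IsManifold 𝓘(ℝ, E) ∞ M] in
theorem IsSmoothGlobalFlow.hasMFDerivAt_map {φ : ℝ → M → M} (hφ : IsSmoothGlobalFlow 𝓘(ℝ, E) φ)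
    (t : ℝ) (q : M) : HasMFDerivAt 𝓘(ℝ, E) 𝓘(ℝ, E) (φ t) q (flowDeriv (E := E) φ t q) :=
  ((hφ.contMDiff_map t).mdifferentiableAt (by simp)).hasMFDerivAt

omit [IsManifold 𝓘(ℝ, E) ∞ M] in
theorem IsSmoothGlobalFlow.flowDeriv_zero {φ : ℝ → M → M} (hφ : IsSmoothGlobalFlow 𝓘(ℝ, E) φ)
    (q : M) : flowDeriv (E := E) φ 0 q = .id ℝ E := by
  have h : φ 0 = id := funext hφ.zero
  have h1 := hφ.hasMFDerivAt_map 0 q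
  rw [h] at h1
  exact hasMFDerivAt_unique h1 (hasMFDerivAt_id q)

omit [IsManifold 𝓘(ℝ, E) ∞ M] in
theorem IsSmoothGlobalFlow.flowDeriv_add {φ : ℝ → M → M} (hφ : IsSmoothGlobalFlow 𝓘(ℝ, E) φ)
    (s t : ℝ) (q : M) : flowDeriv (E := E) φ (s + t) q =
      (flowDeriv φ s (φ t q)).comp (flowDeriv φ t q) := by
  have h : φ (s + t) = φ s ∘ φ t := funext fun x ↦ (hφ.add s t x).symm
  have h1 := (hφ.hasMFDerivAt_map s (φ t q)).comp q (hφ.hasMFDerivAt_map t q)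
  rw [← h] at h1
  exact h1.mfderiv

variable {φ : ℝ → M → M} {Φ : ℝ → M ≃ M}

/-- In coordinates the fibre part is the fibre coordinate of `p` composed with the coordinate
expression of `dφ^{-t}` at `φ^t q`; both factors depend smoothly on `(t, p)`. -/
theorem contMDiff_liftCotangent (hφ : IsSmoothGlobalFlow 𝓘(ℝ, E) φ)
    (hΦ : ∀ t, ⇑(Φ t) = φ t) (hΦ' : ∀ t, ⇑(Φ t).symm = φ (-t)) :
    ContMDiff (𝓘(ℝ, ℝ).prod (cotangentModel E)) (cotangentModel E) ∞
      (fun z : ℝ × CotangentBundle E M ↦ liftCotangent (Φ z.1) z.2) := by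
  rintro ⟨t₀, p₀⟩
  have hproj : ContMDiff (𝓘(ℝ, ℝ).prod (cotangentModel E)) 𝓘(ℝ, E) ∞
      (fun z : ℝ × CotangentBundle E M ↦ z.2.proj) :=
    (contMDiff_proj (fun x : M ↦ TangentSpace 𝓘(ℝ, E) x →L[ℝ] Trivial M ℝ x)).comp contMDiff_snd
  have hbase : ContMDiff (𝓘(ℝ, ℝ).prod (cotangentModel E)) 𝓘(ℝ, E) ∞
      (fun z : ℝ × CotangentBundle E M ↦ φ z.1 z.2.proj) :=
    hφ.smooth.comp (contMDiff_fst.prodMk hproj)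
  have hval (z : ℝ × CotangentBundle E M) : covectorValue (liftCotangent (Φ z.1) z.2) =
      (covectorValue z.2).comp (flowDeriv φ (-z.1) (φ z.1 z.2.proj)) := by
    rw [← hΦ z.1]
    exact congrArg (fun f ↦ (covectorValue z.2).comp
      (show E →L[ℝ] E from mfderiv 𝓘(ℝ, E) 𝓘(ℝ, E) f (Φ z.1 z.2.proj))) (hΦ' z.1)
  have hlift (z : ℝ × CotangentBundle E M) :
      (liftCotangent (Φ z.1) z.2).proj = φ z.1 z.2.proj := congrFun (hΦ z.1) _
  have hlift₀ : (liftCotangent (Φ t₀) p₀).proj = φ t₀ p₀.proj := hlift (t₀, p₀)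
  rw [contMDiffAt_cotangent_iff]
  simp only [hval, hlift, hlift₀]
  refine ⟨hbase.contMDiffAt, ?_⟩
  have h1 := (contMDiffAt_cotangent_iff.1
    (contMDiffAt_snd (I := 𝓘(ℝ, ℝ)) (J := cotangentModel E) (n := ∞) (p := (t₀, p₀)))).2
  have h2 := ContMDiffAt.mfderiv (I := 𝓘(ℝ, E)) (I' := 𝓘(ℝ, E)) (m := ∞) (n := ∞)
    (J := 𝓘(ℝ, ℝ).prod (cotangentModel E)) (x₀ := (t₀, p₀))
    (fun (z : ℝ × CotangentBundle E M) x ↦ φ (-z.1) x) (fun z ↦ φ z.1 z.2.proj)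
    (ContMDiff.contMDiffAt (by
      refine hφ.smooth.comp (ContMDiff.prodMk ?_ contMDiff_snd)
      exact (contMDiff_fst.comp contMDiff_fst).neg)) hbase.contMDiffAt (by simp)
  refine (h1.clm_comp h2).congr_of_eventuallyEq ?_
  have hs1 : ∀ᶠ z in 𝓝 (t₀, p₀), φ z.1 z.2.proj ∈ (extChartAt 𝓘(ℝ, E) (φ t₀ p₀.proj)).source :=
    (hbase.continuous.continuousAt (x := (t₀, p₀))).eventually
    (extChartAt_source_mem_nhds (I := 𝓘(ℝ, E)) (φ t₀ p₀.proj))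
  have hs2 : ∀ᶠ z in 𝓝 (t₀, p₀), z.2.proj ∈ (extChartAt 𝓘(ℝ, E) p₀.proj).source :=
    (hproj.continuous.continuousAt (x := (t₀, p₀))).eventually
    (extChartAt_source_mem_nhds (I := 𝓘(ℝ, E)) p₀.proj)
  have hneg (z : ℝ × CotangentBundle E M) : φ (-z.1) (φ z.1 z.2.proj) = z.2.proj := by
    rw [hφ.add, neg_add_cancel, hφ.zero]
  filter_upwards [hs1, hs2] with z hz1 hz2
  have h4 := inTangentCoordinates_eq_chartDeriv
    (fun z : ℝ × CotangentBundle E M ↦ φ z.1 z.2.proj)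
    (fun z : ℝ × CotangentBundle E M ↦ φ (-z.1) (φ z.1 z.2.proj))
    (fun z ↦ flowDeriv φ (-z.1) (φ z.1 z.2.proj)) (x₀ := (t₀, p₀)) (x := z) hz1
    (by simpa only [hneg, hneg (t₀, p₀)] using hz2)
  have hneg₀ : φ (-t₀) (φ t₀ p₀.proj) = p₀.proj := hneg (t₀, p₀)
  have h5 : chartDeriv (E := E) (φ (-t₀) (φ t₀ p₀.proj)) (φ (-z.1) (φ z.1 z.2.proj)) =
      chartDeriv p₀.proj z.2.proj := by rw [hneg z, hneg₀]
  beta_reduce at h4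
  rw [h5] at h4
  -- The product of the two factors contains `chartSymmDeriv ∘ chartDeriv` at `q`, which is the
  -- identity.
  refine Eq.trans ?_ (congrArg (((covectorValue z.2).comp (chartSymmDeriv p₀.proj
    (extChartAt 𝓘(ℝ, E) p₀.proj z.2.proj))).comp) h4).symm
  have h3 := chartSymmDeriv_comp_chartDeriv ((extChartAt 𝓘(ℝ, E) p₀.proj).map_source hz2)
  rw [(extChartAt 𝓘(ℝ, E) p₀.proj).left_inv hz2] at h3
  rw [← ContinuousLinearMap.comp_assoc _ (chartDeriv p₀.proj z.2.proj),
    ContinuousLinearMap.comp_assoc (covectorValue z.2) (chartSymmDeriv _ _), h3,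
    ContinuousLinearMap.comp_id, ContinuousLinearMap.comp_assoc]

/-- The lifts to the cotangent bundle of the maps of a smooth global flow form a smooth global
flow. -/
theorem isSmoothGlobalFlow_liftCotangent (hφ : IsSmoothGlobalFlow 𝓘(ℝ, E) φ)
    (hΦ : ∀ t, ⇑(Φ t) = φ t) (hΦ' : ∀ t, ⇑(Φ t).symm = φ (-t)) :
    IsSmoothGlobalFlow (cotangentModel E)
      (fun t (p : CotangentBundle E M) ↦ liftCotangent (Φ t) p) := by
  have hval (t : ℝ) (p : CotangentBundle E M) : covectorValue (liftCotangent (Φ t) p) =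
      (covectorValue p).comp (flowDeriv φ (-t) (φ t p.proj)) := by
    rw [← hΦ t]
    exact congrArg (fun f ↦ (covectorValue p).comp
      (show E →L[ℝ] E from mfderiv 𝓘(ℝ, E) 𝓘(ℝ, E) f (Φ t p.proj))) (hΦ' t)
  have hlift (t : ℝ) (p : CotangentBundle E M) : (liftCotangent (Φ t) p).proj = φ t p.proj :=
    congrFun (hΦ t) _
  refine ⟨contMDiff_liftCotangent hφ hΦ hΦ', fun p ↦ covector_ext ?_ ?_,
    fun s t p ↦ covector_ext ?_ ?_⟩
  · rw [hlift, hφ.zero]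
  · rw [hval, neg_zero, hφ.flowDeriv_zero, ContinuousLinearMap.comp_id]
  · rw [hlift, hlift, hlift, hφ.add]
  · rw [hval, hval, hval, hlift, ContinuousLinearMap.comp_assoc, neg_add_rev, hφ.flowDeriv_add]
    rw [hφ.add s t, hφ.add (-s), neg_add_cancel_left]

end LiftFlow

/-! ### The exterior derivative in charts -/

section FormsInCharts

open Filter

variable {E : Type*} [NormedAddCommGroup E] [NormedSpace ℝ E]
  {H : Type*} [TopologicalSpace H] {I : ModelWithCorners ℝ E H} [I.Boundaryless]
  {N : Type*} [TopologicalSpace N] [ChartedSpace H N]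

/-- The derivative at `y` of the inverse of the preferred chart at `x₀`, as an operator of the model
space. -/
noncomputable def extChartSymmDeriv (I : ModelWithCorners ℝ E H) (x₀ : N) (y : E) : E →L[ℝ] E :=
  mfderiv 𝓘(ℝ, E) I (extChartAt I x₀).symm y

/-- The value at a point of a differential form, as a form on the model space. -/
def formValue {k : ℕ} (α : (x : N) → TangentSpace I x [⋀^Fin k]→L[ℝ] ℝ) (x : N) :
    E [⋀^Fin k]→L[ℝ] ℝ := α x

theorem formInChart_eq {k : ℕ} (α : (x : N) → TangentSpace I x [⋀^Fin k]→L[ℝ] ℝ) (x₀ : N) (y : E) :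
    formInChart I α x₀ y = (formValue α ((extChartAt I x₀).symm y)).compContinuousLinearMap
      (extChartSymmDeriv I x₀ y) := by
  rw [formInChart, ModelWithCorners.range_eq_univ, mfderivWithin_univ]
  rfl

variable [IsManifold I ∞ N]

theorem mdifferentiableAt_extChartAt_symm {x₀ : N} {y : E} (hy : y ∈ (extChartAt I x₀).target) :
    MDifferentiableAt 𝓘(ℝ, E) I (extChartAt I x₀).symm y := by
  have := mdifferentiableWithinAt_extChartAt_symm hy
  rwa [ModelWithCorners.range_eq_univ, mdifferentiableWithinAt_univ] at this

theorem contDiffAt_extChartAt_coordChange {x₀ x₁ : N} {y : E} (hy : y ∈ (extChartAt I x₀).target)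
    (hy' : (extChartAt I x₀).symm y ∈ (extChartAt I x₁).source) :
    ContDiffAt ℝ ∞ (extChartAt I x₁ ∘ (extChartAt I x₀).symm) y := by
  have := contDiffWithinAt_ext_coord_change (I := I) (n := ∞) x₁ x₀ (y := y)
    (by simpa using ⟨by simpa using hy, by simpa using hy'⟩)
  rwa [ModelWithCorners.range_eq_univ, contDiffWithinAt_univ] at this

theorem extChartSymmDeriv_transition {x₀ x₁ : N} {y : E} (hy : y ∈ (extChartAt I x₀).target)
    (hy' : (extChartAt I x₀).symm y ∈ (extChartAt I x₁).source) :
    extChartSymmDeriv I x₀ y =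
      (extChartSymmDeriv I x₁ (extChartAt I x₁ ((extChartAt I x₀).symm y))).comp
        (fderiv ℝ (extChartAt I x₁ ∘ (extChartAt I x₀).symm) y) := by
  set T := extChartAt I x₁ ∘ (extChartAt I x₀).symm
  have hT : HasMFDerivAt 𝓘(ℝ, E) 𝓘(ℝ, E) T y (fderiv ℝ T y) :=
    ((contDiffAt_extChartAt_coordChange hy hy').differentiableAt
      (by simp)).hasFDerivAt.hasMFDerivAt
  have h1 := (mdifferentiableAt_extChartAt_symm
    ((extChartAt I x₁).map_source hy')).hasMFDerivAt.comp y hT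
  have hev : (extChartAt I x₀).symm =ᶠ[𝓝 y] (extChartAt I x₁).symm ∘ T := by
    have hc : ContinuousAt (extChartAt I x₀).symm y := continuousAt_extChartAt_symm'' hy
    filter_upwards [hc.eventually (extChartAt_source_mem_nhds' hy')] with z hz
    exact ((extChartAt I x₁).left_inv hz).symm
  exact (h1.congr_of_eventuallyEq hev).mfderiv

/-- Tangent vectors at a point are expressed in the preferred chart there, so this derivative is
that of a transition map. -/
theorem extChartSymmDeriv_eq_fderiv {x₀ : N} {y : E} (hy : y ∈ (extChartAt I x₀).target) :
    extChartSymmDeriv I x₀ y =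
      fderiv ℝ (extChartAt I ((extChartAt I x₀).symm y) ∘ (extChartAt I x₀).symm) y := by
  rw [extChartSymmDeriv, (mdifferentiableAt_extChartAt_symm hy).mfderiv]
  simp only [writtenInExtChartAt, extChartAt_model_space_eq_id, PartialEquiv.refl_coe,
    PartialEquiv.refl_symm, comp_id, id_eq, modelWithCornersSelf_coe, range_id, fderivWithin_univ]

theorem formInChart_transition {k : ℕ} (α : (x : N) → TangentSpace I x [⋀^Fin k]→L[ℝ] ℝ)
    {x₀ x₁ : N} {y : E} (hy : y ∈ (extChartAt I x₀).target)
    (hy' : (extChartAt I x₀).symm y ∈ (extChartAt I x₁).source) :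
    formInChart I α x₀ y =
      (formInChart I α x₁ ((extChartAt I x₁ ∘ (extChartAt I x₀).symm) y)).compContinuousLinearMap
        (fderiv ℝ (extChartAt I x₁ ∘ (extChartAt I x₀).symm) y) := by
  rw [formInChart_eq, formInChart_eq, comp_apply, (extChartAt I x₁).left_inv hy',
    extChartSymmDeriv_transition hy hy']
  rfl

/-- The preferred chart at `x` has identity derivative at `x`, so no pullback remains. -/
theorem formValue_extDerivForm {k : ℕ} (α : (x : N) → TangentSpace I x [⋀^Fin k]→L[ℝ] ℝ) (x : N) :
    formValue (extDerivForm I α) x = extDeriv (formInChart I α x) (extChartAt I x x) := by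
  have h : (mfderiv I 𝓘(ℝ, E) (extChartAt I x) x : E →L[ℝ] E) = .id ℝ E := mfderiv_extChartAt_self
  have h' : formValue (extDerivForm I α) x =
      (extDeriv (formInChart I α x) (extChartAt I x x)).compContinuousLinearMap
        (mfderiv I 𝓘(ℝ, E) (extChartAt I x) x : E →L[ℝ] E) := by
    rw [← extDerivWithin_univ, ← ModelWithCorners.range_eq_univ I]
    rfl
  rw [h', h]
  rfl

/-- The exterior derivative may be computed in any chart. -/
theorem formInChart_extDerivForm {k : ℕ} {α : (x : N) → TangentSpace I x [⋀^Fin k]→L[ℝ] ℝ}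
    (hα : IsSmoothForm I α) {x₀ : N} {y : E} (hy : y ∈ (extChartAt I x₀).target) :
    formInChart I (extDerivForm I α) x₀ y = extDeriv (formInChart I α x₀) y := by
  set x := (extChartAt I x₀).symm y with hx
  set T := extChartAt I x ∘ (extChartAt I x₀).symm with hT
  have hxs : (extChartAt I x₀).symm y ∈ (extChartAt I x).source := mem_extChartAt_source x
  have hev : formInChart I α x₀ =ᶠ[𝓝 y] fun z ↦
      (formInChart I α x (T z)).compContinuousLinearMap (fderiv ℝ T z) := by
    have hc : ContinuousAt (extChartAt I x₀).symm y := continuousAt_extChartAt_symm'' hy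
    filter_upwards [hc.eventually (extChartAt_source_mem_nhds' hxs),
      (isOpen_extChartAt_target x₀).mem_nhds hy] with z hz hz'
    exact formInChart_transition α hz' hz
  have hd : DifferentiableAt ℝ (formInChart I α x) (T y) :=
    ((hα x).contDiffAt ((isOpen_extChartAt_target x).mem_nhds
      ((extChartAt I x).map_source hxs))).differentiableAt (by simp)
  -- The exterior derivative commutes with pullback by the transition map `T`, which is at least
  -- `C^2`.
  rw [hev.extDeriv_eq, extDeriv_pullback hd (contDiffAt_extChartAt_coordChange hy hxs)
    (r := ∞) (by simpa using WithTop.coe_le_coe.2 (le_top : (2 : ℕ∞) ≤ ⊤)), formInChart_eq, formValue_extDerivForm, extChartSymmDeriv_eq_fderiv hy]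
  rfl

end FormsInCharts

/-! ### The canonical symplectic form of the cotangent bundle -/

section CanonicalForm

open Filter

/-! ### The linear model `E × E*` -/

section Model

theorem extDeriv_const {V : Type*} [NormedAddCommGroup V] [NormedSpace ℝ V] {k : ℕ}
    (α : V [⋀^Fin k]→L[ℝ] ℝ) (x : V) : extDeriv (fun _ ↦ α) x = 0 := by
  ext v
  rw [extDeriv_apply (differentiableAt_const α)]
  simp

variable (E : Type*) [NormedAddCommGroup E] [NormedSpace ℝ E]

/-- The tautological form of `E × E*`. -/
noncomputable def modelTautologicalForm :
    E × (E →L[ℝ] ℝ) → (E × (E →L[ℝ] ℝ)) [⋀^Fin 1]→L[ℝ] ℝ := fun z ↦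
  ContinuousAlternatingMap.ofSubsingleton ℝ (E × (E →L[ℝ] ℝ)) ℝ (0 : Fin 1)
    (z.2.comp (ContinuousLinearMap.fst ℝ E (E →L[ℝ] ℝ)))

theorem modelTautologicalForm_apply (z : E × (E →L[ℝ] ℝ)) (v : Fin 1 → E × (E →L[ℝ] ℝ)) :
    modelTautologicalForm E z v = z.2 (v 0).1 := rfl

theorem contDiff_modelTautologicalForm {n : WithTop ℕ∞} :
    ContDiff ℝ n (modelTautologicalForm E) := by
  have h : ContDiff ℝ n (fun z : E × (E →L[ℝ] ℝ) ↦
      z.2.comp (ContinuousLinearMap.fst ℝ E (E →L[ℝ] ℝ))) := contDiff_snd.clm_comp contDiff_const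
  exact (ContinuousAlternatingMap.ofSubsingletonLIE (𝕜 := ℝ) (0 : Fin 1)).contDiff.comp h

theorem extDeriv_modelTautologicalForm_apply (z a b : E × (E →L[ℝ] ℝ)) :
    extDeriv (modelTautologicalForm E) z ![a, b] = a.2 b.1 - b.2 a.1 := by
  have h (u : E) : fderiv ℝ (fun z : E × (E →L[ℝ] ℝ) ↦ z.2 u) z =
      (ContinuousLinearMap.apply ℝ ℝ u).comp (ContinuousLinearMap.snd ℝ E (E →L[ℝ] ℝ)) :=
    ((ContinuousLinearMap.apply ℝ ℝ u).comp
      (ContinuousLinearMap.snd ℝ E (E →L[ℝ] ℝ))).hasFDerivAt.fderiv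
  rw [extDeriv_apply ((contDiff_modelTautologicalForm E (n := 1)).differentiable (by simp) z)]
  simp [Fin.sum_univ_two, modelTautologicalForm_apply, h, Fin.removeNth, sub_eq_add_neg]

/-- The canonical symplectic form of `E × E*`. -/
noncomputable def modelCanonicalForm : (E × (E →L[ℝ] ℝ)) [⋀^Fin 2]→L[ℝ] ℝ :=
  -extDeriv (modelTautologicalForm E) 0

theorem modelCanonicalForm_apply (a b : E × (E →L[ℝ] ℝ)) :
    modelCanonicalForm E ![a, b] = b.2 a.1 - a.2 b.1 := by
  rw [modelCanonicalForm, ContinuousAlternatingMap.neg_apply,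
    extDeriv_modelTautologicalForm_apply, neg_sub]

/-- The coefficients of the tautological form are linear in `z`, so its exterior derivative is the
same at every point as at `0`. -/
theorem neg_extDeriv_modelTautologicalForm (z : E × (E →L[ℝ] ℝ)) :
    -extDeriv (modelTautologicalForm E) z = modelCanonicalForm E := by
  ext v
  obtain ⟨a, b, rfl⟩ : ∃ a b, v = ![a, b] := ⟨v 0, v 1, by ext i : 1; fin_cases i <;> rfl⟩
  rw [modelCanonicalForm_apply, ContinuousAlternatingMap.neg_apply,
    extDeriv_modelTautologicalForm_apply, neg_sub]

/-- The vector component comes from reflexivity of the finite-dimensional space `E`, the covector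
component is minus the restriction of `l` to `E`. -/
theorem existsUnique_modelCanonicalForm_eq [FiniteDimensional ℝ E]
    (l : (E × (E →L[ℝ] ℝ)) →L[ℝ] ℝ) : ∃! a, ∀ b, modelCanonicalForm E ![a, b] = l b := by
  simp only [modelCanonicalForm_apply]
  obtain ⟨u, hu⟩ : ∃ u : E, ∀ η : E →L[ℝ] ℝ, η u = l (0, η) := by
    let l' : Module.Dual ℝ (Module.Dual ℝ E) :=
      (l.comp (ContinuousLinearMap.inr ℝ E (E →L[ℝ] ℝ))).toLinearMap.comp
        (LinearMap.toContinuousLinearMap (𝕜 := ℝ) (E := E) (F' := ℝ)).toLinearMap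
    refine ⟨(Module.evalEquiv ℝ E).symm l', fun η ↦ ?_⟩
    have := Module.apply_evalEquiv_symm_apply (R := ℝ) (M := E) η.toLinearMap l'
    exact this
  refine ⟨(u, -l.comp (ContinuousLinearMap.inl ℝ E (E →L[ℝ] ℝ))), fun b ↦ ?_, fun a ha ↦ ?_⟩
  · simp only [hu, neg_apply, ContinuousLinearMap.comp_apply,
      ContinuousLinearMap.inl_apply, sub_neg_eq_add]
    rw [← map_add]
    simp
  · have h2 : a.2 = -l.comp (ContinuousLinearMap.inl ℝ E (E →L[ℝ] ℝ)) := by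
      ext x
      have := ha (x, 0)
      simp at this
      simp [← this]
    have h1 : a.1 = u := by
      refine (SeparatingDual.eq_iff_forall_dual_eq (R := ℝ)).2 fun η ↦ ?_
      have := ha (0, η)
      simp at this
      rw [hu, this]
    exact Prod.ext h1 h2

end Model

/-! ### Transfer from the model to the cotangent bundle -/

variable (E : Type*) [NormedAddCommGroup E] [NormedSpace ℝ E]
  (M : Type*) [TopologicalSpace M] [ChartedSpace E M] [IsManifold 𝓘(ℝ, E) ∞ M]

/-- Bundle charts turn the projection into `Prod.fst` and transport covectors by the chart
derivative; this cancels the inverse chart derivative coming from the base (`hD`). -/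
theorem formInChart_tautologicalForm {p₀ : CotangentBundle E M} {z : E × (E →L[ℝ] ℝ)}
    (hz : z ∈ (extChartAt (cotangentModel E) p₀).target) :
    formInChart (cotangentModel E) (tautologicalForm E M) p₀ z = modelTautologicalForm E z := by
  have hz' := mem_extChartAt_cotangent_target.1 hz
  set p := (extChartAt (cotangentModel E) p₀).symm z with hp
  have hD : (mfderiv (cotangentModel E) 𝓘(ℝ, E) (fun r : CotangentBundle E M ↦ r.proj) p :
      E × (E →L[ℝ] ℝ) →L[ℝ] E).comp (extChartSymmDeriv (cotangentModel E) p₀ z) =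
      (chartSymmDeriv p₀.proj z.1).comp (ContinuousLinearMap.fst ℝ E (E →L[ℝ] ℝ)) := by
    have hπ : MDifferentiableAt (cotangentModel E) 𝓘(ℝ, E)
        (fun r : CotangentBundle E M ↦ r.proj) p :=
      (contMDiff_proj (n := ∞) (IB := 𝓘(ℝ, E)) (F := E →L[ℝ] ℝ)
        (fun x : M ↦ TangentSpace 𝓘(ℝ, E) x →L[ℝ] Trivial M ℝ x)).mdifferentiableAt (by simp)
    have h1 := HasMFDerivAt.comp (g := fun r : CotangentBundle E M ↦ r.proj)
      (f := (extChartAt (cotangentModel E) p₀).symm) z hπ.hasMFDerivAt (mdifferentiableAt_extChartAt_symm hz).hasMFDerivAt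
    have h2 : MDifferentiableAt 𝓘(ℝ, E) 𝓘(ℝ, E) (extChartAt 𝓘(ℝ, E) p₀.proj).symm z.1 :=
      mdifferentiableAt_extChartAt_symm hz'
    have h3 := h2.hasMFDerivAt.comp z
      (hasFDerivAt_fst (𝕜 := ℝ) (E := E) (F := E →L[ℝ] ℝ) (p := z)).hasMFDerivAt
    have hev : (extChartAt 𝓘(ℝ, E) p₀.proj).symm ∘ Prod.fst =ᶠ[𝓝 z]
        (fun r : CotangentBundle E M ↦ r.proj) ∘ (extChartAt (cotangentModel E) p₀).symm := by
      filter_upwards [(isOpen_extChartAt_target p₀).mem_nhds hz] with w hw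
      rw [comp_apply, comp_apply,
        extChartAt_cotangent_symm_apply (mem_extChartAt_cotangent_target.1 hw), covector_proj]
    exact h1.mfderiv.symm.trans (h3.congr_of_eventuallyEq hev.symm).mfderiv
  rw [formInChart_eq]
  ext v
  change covectorValue p (((mfderiv (cotangentModel E) 𝓘(ℝ, E)
    (fun r : CotangentBundle E M ↦ r.proj) p : E × (E →L[ℝ] ℝ) →L[ℝ] E).comp
      (extChartSymmDeriv (cotangentModel E) p₀ z)) (v 0)) = z.2 (v 0).1
  rw [hD, hp, extChartAt_cotangent_symm_apply hz', covectorValue_covector]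
  exact congr(z.2 ($(chartDeriv_comp_chartSymmDeriv hz') (v 0).1))

theorem isSmoothForm_tautologicalForm :
    IsSmoothForm (cotangentModel E) (tautologicalForm E M) := fun _ ↦
  (contDiff_modelTautologicalForm E).contDiffOn.congr fun _ hz ↦
    formInChart_tautologicalForm E M hz

theorem formInChart_canonicalForm {p₀ : CotangentBundle E M} {z : E × (E →L[ℝ] ℝ)}
    (hz : z ∈ (extChartAt (cotangentModel E) p₀).target) :
    formInChart (cotangentModel E) (canonicalForm E M) p₀ z = modelCanonicalForm E := by
  have h1 : formInChart (cotangentModel E) (canonicalForm E M) p₀ z =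
      -formInChart (cotangentModel E)
        (extDerivForm (cotangentModel E) (tautologicalForm E M)) p₀ z := rfl
  have hev : formInChart (cotangentModel E) (tautologicalForm E M) p₀ =ᶠ[𝓝 z]
      modelTautologicalForm E := by
    filter_upwards [(isOpen_extChartAt_target p₀).mem_nhds hz] with w hw
    exact formInChart_tautologicalForm E M hw
  rw [h1, formInChart_extDerivForm (isSmoothForm_tautologicalForm E M) hz, hev.extDeriv_eq,
    neg_extDeriv_modelTautologicalForm]

/-- Evaluation at the centre of the chart, where the tangent space is already identified with `E ×
E*`; pointwise nondegeneracy is read off from this. -/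
theorem formValue_canonicalForm (p : CotangentBundle E M) :
    formValue (canonicalForm E M) p = modelCanonicalForm E := by
  have h1 : formValue (canonicalForm E M) p =
      -formValue (extDerivForm (cotangentModel E) (tautologicalForm E M)) p := rfl
  have hev : formInChart (cotangentModel E) (tautologicalForm E M) p
      =ᶠ[𝓝 (extChartAt (cotangentModel E) p p)] modelTautologicalForm E := by
    filter_upwards [extChartAt_target_mem_nhds p] with w hw
    exact formInChart_tautologicalForm E M hw
  rw [h1, formValue_extDerivForm, hev.extDeriv_eq, neg_extDeriv_modelTautologicalForm]

theorem isSymplecticForm_canonicalForm [FiniteDimensional ℝ E] :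
    IsSymplecticForm (cotangentModel E) (canonicalForm E M) where
  smooth _ := contDiffOn_const.congr fun _ hz ↦ formInChart_canonicalForm E M hz
  closed p := by
    have hev : formInChart (cotangentModel E) (canonicalForm E M) p
        =ᶠ[𝓝 (extChartAt (cotangentModel E) p p)] fun _ ↦ modelCanonicalForm E := by
      filter_upwards [extChartAt_target_mem_nhds p] with w hw
      exact formInChart_canonicalForm E M hw
    change formValue (extDerivForm (cotangentModel E) (canonicalForm E M)) p = 0
    rw [formValue_extDerivForm, hev.extDeriv_eq, extDeriv_const]
  nondegenerate p l := by
    have h := existsUnique_modelCanonicalForm_eq E l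
    rw [← formValue_canonicalForm E M p] at h
    exact h

end CanonicalForm

/-! ### The cotangent lift is Hamiltonian -/

section Hamiltonian

open Filter

/-- Symmetry of the mixed derivative of a map that depends on a time parameter: the time derivative
of the space derivative is the space derivative of the time derivative. -/
theorem hasDerivAt_fderiv_comp_inr {V W : Type*} [NormedAddCommGroup V] [NormedSpace ℝ V]
    [NormedAddCommGroup W] [NormedSpace ℝ W] {F : ℝ × V → W} {t : ℝ} {x : V}
    (hF : ContDiffAt ℝ 2 F (t, x)) {g : V → W}
    (hg : ∀ᶠ y in 𝓝 x, HasDerivAt (fun s ↦ F (s, y)) (g y) t) :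
    HasDerivAt (fun s ↦ (fderiv ℝ F (s, x)).comp (ContinuousLinearMap.inr ℝ ℝ V))
      (fderiv ℝ g x) t := by
  have hF' : HasFDerivAt (fderiv ℝ F) (fderiv ℝ (fderiv ℝ F) (t, x)) (t, x) :=
    ((hF.fderiv_right (m := 1) (by norm_num)).differentiableAt (by simp)).hasFDerivAt
  have hd : ∀ᶠ z in 𝓝 (t, x), DifferentiableAt ℝ F z :=
    (hF.eventually (by simp)).mono fun z hz ↦ hz.differentiableAt (by simp)
  have h1 : HasDerivAt (fun s : ℝ ↦ (s, x)) ((1 : ℝ), (0 : V)) t :=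
    (hasDerivAt_id t).prodMk (hasDerivAt_const t x)
  have h2 : HasDerivAt (fun s ↦ (fderiv ℝ F (s, x)).comp (ContinuousLinearMap.inr ℝ ℝ V))
      ((fderiv ℝ (fderiv ℝ F) (t, x) (1, 0)).comp (ContinuousLinearMap.inr ℝ ℝ V)) t :=
    ((ContinuousLinearMap.compL ℝ V (ℝ × V) W).flip
      (ContinuousLinearMap.inr ℝ ℝ V)).hasFDerivAt.comp_hasDerivAt t (hF'.comp_hasDerivAt t h1)
  have hx : ContinuousAt (fun y ↦ (t, y)) x := by fun_prop
  have hg' : g =ᶠ[𝓝 x] fun y ↦ fderiv ℝ F (t, y) (1, 0) := by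
    filter_upwards [hg, hx.eventually hd] with y hy hy'
    have h4 : HasDerivAt (fun s : ℝ ↦ (s, y)) ((1 : ℝ), (0 : V)) t :=
      (hasDerivAt_id t).prodMk (hasDerivAt_const t y)
    exact hy.unique (hy'.hasFDerivAt.comp_hasDerivAt t h4)
  have h3 : HasFDerivAt (fun y ↦ fderiv ℝ F (t, y) (1, 0))
      ((ContinuousLinearMap.apply ℝ W ((1 : ℝ), (0 : V))).comp
        ((fderiv ℝ (fderiv ℝ F) (t, x)).comp (ContinuousLinearMap.inr ℝ ℝ V))) x :=
    (ContinuousLinearMap.apply ℝ W ((1 : ℝ), (0 : V))).hasFDerivAt.comp x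
      (hF'.comp x (hasFDerivAt_prodMk_right t x))
  have hsymm : IsSymmSndFDerivAt ℝ F (t, x) := hF.isSymmSndFDerivAt (by simp)
  have h5 : fderiv ℝ g x =
      (fderiv ℝ (fderiv ℝ F) (t, x) (1, 0)).comp (ContinuousLinearMap.inr ℝ ℝ V) := by
    rw [hg'.fderiv_eq, h3.fderiv]
    ext w
    exact hsymm.eq (0, w) (1, 0)
  rw [h5]
  exact h2

variable {E : Type*} [NormedAddCommGroup E] [NormedSpace ℝ E]

/-- The velocity of a curve is the derivative of its expression in the chart at its base point. -/
theorem HasMFDerivAt.hasDerivAt_extChartAt {H : Type*} [TopologicalSpace H]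
    {I : ModelWithCorners ℝ E H} {N : Type*} [TopologicalSpace N] [ChartedSpace H N]
    {γ : ℝ → N} {t : ℝ} {p : N} {v : E}
    (hγ : HasMFDerivAt 𝓘(ℝ, ℝ) I γ t ((1 : ℝ →L[ℝ] ℝ).smulRight v)) (hp : γ t = p) :
    HasDerivAt (extChartAt I p ∘ γ) v t := by
  subst hp
  have h := hγ.2
  simp only [writtenInExtChartAt, extChartAt_model_space_eq_id, PartialEquiv.refl_coe,
    PartialEquiv.refl_symm, comp_id, id_eq, modelWithCornersSelf_coe, range_id] at h
  have h' : HasFDerivAt (extChartAt I (γ t) ∘ γ) ((1 : ℝ →L[ℝ] ℝ).smulRight v) t :=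
    hasFDerivWithinAt_univ.1 h
  simpa using h'.hasDerivAt

variable {M : Type*} [TopologicalSpace M] [ChartedSpace E M] [IsManifold 𝓘(ℝ, E) ∞ M]

theorem IsMIntegralCurve.hasDerivAt_inChart {X : (q : M) → TangentSpace 𝓘(ℝ, E) q} {γ : ℝ → M}
    (hγ : IsMIntegralCurve (I := 𝓘(ℝ, E)) γ X) {q : M} {t : ℝ}
    (ht : γ t ∈ (extChartAt 𝓘(ℝ, E) q).source) :
    HasDerivAt (extChartAt 𝓘(ℝ, E) q ∘ γ)
      (vectorFieldInChart X q (extChartAt 𝓘(ℝ, E) q (γ t))) t := by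
  have h1 : MDifferentiableAt 𝓘(ℝ, E) 𝓘(ℝ, E) (extChartAt 𝓘(ℝ, E) q) (γ t) :=
    mdifferentiableAt_extChartAt (by simpa using ht)
  have h2 : HasFDerivAt (extChartAt 𝓘(ℝ, E) q ∘ γ) ((chartDeriv q (γ t)).comp
      ((1 : ℝ →L[ℝ] ℝ).smulRight (show E from X (γ t)))) t :=
    hasMFDerivAt_iff_hasFDerivAt.1 (h1.hasMFDerivAt.comp t (hγ t))
  rw [vectorFieldInChart, (extChartAt 𝓘(ℝ, E) q).left_inv ht]
  have h3 {f : ℝ → E} {A : E →L[ℝ] E} {v : E}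
      (h : HasFDerivAt f (A.comp ((1 : ℝ →L[ℝ] ℝ).smulRight v)) t) : HasDerivAt f (A v) t := by
    simpa using h.hasDerivAt
  exact h3 h2

theorem hamiltonianFunction_extChartAt_symm (X : (q : M) → TangentSpace 𝓘(ℝ, E) q)
    {p₀ : CotangentBundle E M} {z : E × (E →L[ℝ] ℝ)}
    (hz : z.1 ∈ (extChartAt 𝓘(ℝ, E) p₀.proj).target) :
    hamiltonianFunction X ((extChartAt (cotangentModel E) p₀).symm z) =
      z.2 (vectorFieldInChart X p₀.proj z.1) := by
  rw [extChartAt_cotangent_symm_apply hz]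
  rfl

theorem contMDiff_hamiltonianFunction {X : (q : M) → TangentSpace 𝓘(ℝ, E) q}
    (hXs : IsSmoothVectorField 𝓘(ℝ, E) X) :
    ContMDiff (cotangentModel E) 𝓘(ℝ, ℝ) ∞ (hamiltonianFunction X) := by
  intro p₀
  have h1 : ContDiffOn ℝ ∞ (fun z : E × (E →L[ℝ] ℝ) ↦ z.2 (vectorFieldInChart X p₀.proj z.1))
      (extChartAt (cotangentModel E) p₀).target :=
    contDiffOn_snd.clm_apply ((hXs.contDiffOn_inChart p₀.proj).comp contDiffOn_fst
      fun z hz ↦ mem_extChartAt_cotangent_target.1 hz)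
  have h2 : ContMDiffAt (cotangentModel E) 𝓘(ℝ, ℝ) ∞
      ((fun z : E × (E →L[ℝ] ℝ) ↦ z.2 (vectorFieldInChart X p₀.proj z.1)) ∘
        extChartAt (cotangentModel E) p₀) p₀ :=
    (h1.contDiffAt (extChartAt_target_mem_nhds p₀)).contMDiffAt.comp p₀
      (contMDiffAt_extChartAt (I := cotangentModel E))
  refine h2.congr_of_eventuallyEq ?_
  filter_upwards [extChartAt_source_mem_nhds (I := cotangentModel E) p₀] with p hp
  have hz := mem_extChartAt_cotangent_target.1 ((extChartAt (cotangentModel E) p₀).map_source hp)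
  rw [comp_apply, ← hamiltonianFunction_extChartAt_symm X hz,
    (extChartAt (cotangentModel E) p₀).left_inv hp]

theorem mfderiv_hamiltonianFunction {X : (q : M) → TangentSpace 𝓘(ℝ, E) q}
    (hXs : IsSmoothVectorField 𝓘(ℝ, E) X) (p : CotangentBundle E M) (w : E × (E →L[ℝ] ℝ)) :
    mfderiv (cotangentModel E) 𝓘(ℝ, ℝ) (hamiltonianFunction X) p w =
      w.2 (vectorFieldInChart X p.proj (extChartAt (cotangentModel E) p p).1) +
      (extChartAt (cotangentModel E) p p).2
        (fderiv ℝ (vectorFieldInChart X p.proj) (extChartAt (cotangentModel E) p p).1 w.1) := by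
  set z := extChartAt (cotangentModel E) p p
  have hz : z ∈ (extChartAt (cotangentModel E) p).target := mem_extChartAt_target p
  have hX : DifferentiableAt ℝ (vectorFieldInChart X p.proj) z.1 :=
    ((hXs.contDiffOn_inChart p.proj).contDiffAt ((isOpen_extChartAt_target p.proj).mem_nhds
      (mem_extChartAt_cotangent_target.1 hz))).differentiableAt (by simp)
  have h1 : HasFDerivAt (fun z : E × (E →L[ℝ] ℝ) ↦ z.2 (vectorFieldInChart X p.proj z.1)) _ z :=
    (hasFDerivAt_snd (𝕜 := ℝ) (p := z)).clm_apply
      (hX.hasFDerivAt.comp z (hasFDerivAt_fst (𝕜 := ℝ) (p := z)))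
  have h2 : hamiltonianFunction X ∘ (extChartAt (cotangentModel E) p).symm =ᶠ[𝓝 z]
      fun z : E × (E →L[ℝ] ℝ) ↦ z.2 (vectorFieldInChart X p.proj z.1) := by
    filter_upwards [(isOpen_extChartAt_target p).mem_nhds hz] with y hy
    exact hamiltonianFunction_extChartAt_symm X (mem_extChartAt_cotangent_target.1 hy)
  have h3 : (mfderiv (cotangentModel E) 𝓘(ℝ, ℝ) (hamiltonianFunction X) p :
      E × (E →L[ℝ] ℝ) →L[ℝ] ℝ) =
      fderiv ℝ (hamiltonianFunction X ∘ (extChartAt (cotangentModel E) p).symm) z := by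
    rw [((contMDiff_hamiltonianFunction hXs).mdifferentiableAt (by simp)).mfderiv,
      ModelWithCorners.range_eq_univ, fderivWithin_univ]
    rfl
  have h4 : fderiv ℝ (fun z : E × (E →L[ℝ] ℝ) ↦ z.2 (vectorFieldInChart X p.proj z.1)) z w =
      w.2 (vectorFieldInChart X p.proj z.1) +
        z.2 (fderiv ℝ (vectorFieldInChart X p.proj) z.1 w.1) := by
    rw [h1.fderiv]
    simp [add_comm]
  exact congr($(h3.trans h2.fderiv_eq) w).trans h4

variable [FiniteDimensional ℝ E] [T2Space M]

theorem isSmoothGlobalFlow_liftCotangent_flowEquiv {X : (q : M) → TangentSpace 𝓘(ℝ, E) q}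
    (hXs : IsSmoothVectorField 𝓘(ℝ, E) X) (hX : IsCompleteVectorField 𝓘(ℝ, E) X) :
    IsSmoothGlobalFlow (cotangentModel E) (fun t (p : CotangentBundle E M) ↦
      liftCotangent (flowEquiv 𝓘(ℝ, E) X hXs hX t) p) :=
  isSmoothGlobalFlow_liftCotangent (isSmoothGlobalFlow_flowOf hXs hX) (fun _ ↦ rfl) (fun _ ↦ rfl)

/-- The flow in a chart: its derivative in the space variable, and the time derivative of the
latter. -/
theorem flow_inChart {X : (q : M) → TangentSpace 𝓘(ℝ, E) q}
    (hXs : IsSmoothVectorField 𝓘(ℝ, E) X) (hX : IsCompleteVectorField 𝓘(ℝ, E) X) (q : M) :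
    ∃ D : ℝ → E →L[ℝ] E, D 0 = .id ℝ E ∧
      HasDerivAt D (fderiv ℝ (vectorFieldInChart X q) (extChartAt 𝓘(ℝ, E) q q)) 0 ∧
      ∀ᶠ t in 𝓝 (0 : ℝ), D t = (chartDeriv q (flowOf 𝓘(ℝ, E) X hX t q)).comp
        ((flowDeriv (flowOf 𝓘(ℝ, E) X hX) t q).comp
          (chartSymmDeriv q (extChartAt 𝓘(ℝ, E) q q))) := by
  have hφ := isSmoothGlobalFlow_flowOf hXs hX
  set φ := flowOf 𝓘(ℝ, E) X hX
  set c := extChartAt 𝓘(ℝ, E) q with hc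
  have hcx : c.symm (c q) = q := c.left_inv (mem_extChartAt_source q)
  -- The flow read in the chart. Its space derivative at `c q` serves as `D` for all `t`, although
  -- the chart formula for it holds only near `t = 0`.
  let F : ℝ × E → E := fun z ↦ c (φ z.1 (c.symm z.2))
  have hsymm : ContMDiffAt 𝓘(ℝ, E) 𝓘(ℝ, E) ∞ c.symm (c q) :=
    (contMDiffOn_extChartAt_symm q).contMDiffAt (extChartAt_target_mem_nhds q)
  have hF : ContDiffAt ℝ ∞ F (0, c q) := by
    refine contMDiffAt_iff_contDiffAt.1 ?_
    have h1 : ContMDiffAt 𝓘(ℝ, ℝ × E) 𝓘(ℝ, E) ∞ (fun z : ℝ × E ↦ φ z.1 (c.symm z.2))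
        (0, c q) :=
      ContMDiffAt.comp (I' := 𝓘(ℝ, ℝ).prod 𝓘(ℝ, E)) (g := fun z : ℝ × M ↦ φ z.1 z.2)
        (f := fun z : ℝ × E ↦ (z.1, c.symm z.2)) (0, c q) hφ.smooth.contMDiffAt
        (contDiff_fst.contMDiff.contMDiffAt.prodMk
          (ContMDiffAt.comp (g := c.symm) (f := Prod.snd) (0, c q) hsymm
            contDiff_snd.contMDiff.contMDiffAt))
    refine ContMDiffAt.comp (g := c) (f := fun z : ℝ × E ↦ φ z.1 (c.symm z.2)) (0, c q) ?_ h1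
    simp only [hφ.zero, hcx]
    exact contMDiffAt_extChartAt
  have hsrc : ∀ᶠ t in 𝓝 (0 : ℝ), φ t q ∈ c.source := by
    have hcont : ContinuousAt (fun t ↦ φ t q) 0 :=
      (isMIntegralCurve_flowOf hX q).continuous.continuousAt
    have h0 : φ 0 q = q := hφ.zero q
    exact hcont.eventually (by
      change ∀ᶠ y in 𝓝 (φ 0 q), y ∈ c.source
      rw [h0]; exact extChartAt_source_mem_nhds q)
  have hD : ∀ᶠ t in 𝓝 (0 : ℝ), (fderiv ℝ F (t, c q)).comp (ContinuousLinearMap.inr ℝ ℝ E) =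
      (chartDeriv q (φ t q)).comp ((flowDeriv φ t q).comp (chartSymmDeriv q (c q))) := by
    have hd : ∀ᶠ z in 𝓝 ((0 : ℝ), c q), DifferentiableAt ℝ F z :=
      ((hF.of_le (m := 1) (by simp)).eventually (by simp)).mono
        fun z hz ↦ hz.differentiableAt (by simp)
    have hcont : ContinuousAt (fun t : ℝ ↦ (t, c q)) 0 := by fun_prop
    filter_upwards [hcont.eventually hd, hsrc] with t ht hts
    have h1 := ht.hasFDerivAt.comp (c q) (hasFDerivAt_prodMk_right t (c q))
    have h2 : HasMFDerivAt 𝓘(ℝ, E) 𝓘(ℝ, E) c.symm (c q)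
        (chartSymmDeriv (E := E) q (c q)) :=
      (hsymm.mdifferentiableAt (by simp)).hasMFDerivAt
    have h3 : HasMFDerivAt 𝓘(ℝ, E) 𝓘(ℝ, E) (φ t) (c.symm (c q)) (flowDeriv (E := E) φ t q) := by
      rw [hcx]; exact hφ.hasMFDerivAt_map t q
    have h4 : HasMFDerivAt 𝓘(ℝ, E) 𝓘(ℝ, E) c (φ t (c.symm (c q)))
        (chartDeriv (E := E) q (φ t q)) := by
      rw [hcx]
      exact (mdifferentiableAt_extChartAt (by simpa [hc] using hts)).hasMFDerivAt
    have h5 : HasMFDerivAt 𝓘(ℝ, E) 𝓘(ℝ, E) (fun y ↦ F (t, y)) (c q)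
        ((chartDeriv (E := E) q (φ t q)).comp
          ((flowDeriv (E := E) φ t q).comp (chartSymmDeriv (E := E) q (c q)))) :=
      HasMFDerivAt.comp (g := c) (f := fun y ↦ φ t (c.symm y)) (c q) h4
        (HasMFDerivAt.comp (g := φ t) (f := c.symm) (c q) h3 h2)
    exact h1.unique (hasMFDerivAt_iff_hasFDerivAt.1 h5)
  refine ⟨fun t ↦ (fderiv ℝ F (t, c q)).comp (ContinuousLinearMap.inr ℝ ℝ E), ?_, ?_, hD⟩
  · refine hD.self_of_nhds.trans ?_
    rw [hφ.flowDeriv_zero, hφ.zero, ContinuousLinearMap.id_comp]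
    have := chartDeriv_comp_chartSymmDeriv (mem_extChartAt_target (I := 𝓘(ℝ, E)) q)
    rwa [← hc, hcx] at this
  · refine hasDerivAt_fderiv_comp_inr (hF.of_le 
      (by simpa using WithTop.coe_le_coe.2 (le_top : (2 : ℕ∞) ≤ ⊤))) ?_
    filter_upwards [extChartAt_target_mem_nhds q] with y hy
    have hy0 : φ 0 (c.symm y) = c.symm y := hφ.zero _
    have h := (isMIntegralCurve_flowOf hX (c.symm y)).hasDerivAt_inChart (q := q) (t := 0)
      (by change φ 0 (c.symm y) ∈ c.source; rw [hy0]; exact c.map_target hy)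
    change HasDerivAt (fun s ↦ F (s, y)) (vectorFieldInChart X q (c (φ 0 (c.symm y)))) 0 at h
    rwa [hy0, c.right_inv hy] at h

/-- The cotangent lift in the chart at its base point. -/
theorem cotangentLift_inChart {X : (q : M) → TangentSpace 𝓘(ℝ, E) q}
    (hXs : IsSmoothVectorField 𝓘(ℝ, E) X) (hX : IsCompleteVectorField 𝓘(ℝ, E) X)
    (p : CotangentBundle E M) :
    (cotangentLift X hXs hX p : E × (E →L[ℝ] ℝ)) =
      (vectorFieldInChart X p.proj (extChartAt (cotangentModel E) p p).1,
        -(extChartAt (cotangentModel E) p p).2.comp (fderiv ℝ (vectorFieldInChart X p.proj)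
          (extChartAt (cotangentModel E) p p).1)) := by
  have hφ := isSmoothGlobalFlow_flowOf hXs hX
  have hψ := isSmoothGlobalFlow_liftCotangent_flowEquiv hXs hX
  set φ := flowOf 𝓘(ℝ, E) X hX
  set c := extChartAt 𝓘(ℝ, E) p.proj with hc
  let γ : ℝ → CotangentBundle E M := fun t ↦ liftCotangent (flowEquiv 𝓘(ℝ, E) X hXs hX t) p
  have hγ0 : γ 0 = p := hψ.zero p
  have hγ : HasDerivAt (extChartAt (cotangentModel E) p ∘ γ)
      (cotangentLift X hXs hX p : E × (E →L[ℝ] ℝ)) 0 :=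
    (hψ.hasMFDerivAt_curve_zero p).hasDerivAt_extChartAt hγ0
  obtain ⟨D, hD0, hD, hDt⟩ := flow_inChart hXs hX p.proj
  have hq0 : φ 0 p.proj = p.proj := hφ.zero _
  have hsrc : ∀ᶠ t in 𝓝 (0 : ℝ), φ t p.proj ∈ c.source := by
    have hcont : ContinuousAt (fun t ↦ φ t p.proj) 0 :=
      (isMIntegralCurve_flowOf hX p.proj).continuous.continuousAt
    exact hcont.eventually (by
      change ∀ᶠ y in 𝓝 (φ 0 p.proj), y ∈ c.source
      rw [hq0]; exact extChartAt_source_mem_nhds p.proj)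
  have hγt : ∀ᶠ t in 𝓝 (0 : ℝ), extChartAt (cotangentModel E) p (γ t) = (c (φ t p.proj),
      ((covectorValue p).comp (flowDeriv φ (-t) (φ t p.proj))).comp
        (chartSymmDeriv p.proj (c (φ t p.proj)))) := by
    filter_upwards [hsrc] with t ht
    exact extChartAt_cotangent_apply (p₀ := p) (p := γ t) ht
  have hpp : extChartAt (cotangentModel E) p p =
      (c p.proj, (covectorValue p).comp (chartSymmDeriv p.proj (c p.proj))) :=
    extChartAt_cotangent_apply (mem_extChartAt_source p.proj)
  refine Prod.ext ?_ ?_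
  · have h1 : HasDerivAt (fun t ↦ (extChartAt (cotangentModel E) p (γ t)).1)
        (cotangentLift X hXs hX p : E × (E →L[ℝ] ℝ)).1 0 := hγ.fst
    have h2 := (isMIntegralCurve_flowOf hX p.proj).hasDerivAt_inChart (q := p.proj) (t := 0)
      hsrc.self_of_nhds
    have h3 := h2.congr_of_eventuallyEq (f₁ := fun t ↦ (extChartAt (cotangentModel E) p (γ t)).1)
      (hγt.mono fun t ht ↦ congrArg Prod.fst ht)
    rw [h1.unique h3, hpp]
    exact congrArg (fun y ↦ vectorFieldInChart X p.proj (c y)) hq0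
  · have h1 : HasDerivAt (fun t ↦ (extChartAt (cotangentModel E) p (γ t)).2)
        (cotangentLift X hXs hX p : E × (E →L[ℝ] ℝ)).2 0 := hγ.snd
    -- Instead of differentiating `dφ^{-t}` along the moving point, one differentiates the fibre
    -- coordinate composed with `D t`. This product is constant near `0`, so the product rule gives
    -- `ξ' + ξ ∘ DX = 0`.
    have h2 := h1.clm_comp hD
    have h3 : (fun t ↦ (extChartAt (cotangentModel E) p (γ t)).2.comp (D t)) =ᶠ[𝓝 0]
        fun _ ↦ (extChartAt (cotangentModel E) p p).2 := by
      filter_upwards [hγt, hDt, hsrc] with t h1 h2 hts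
      have h4 := chartSymmDeriv_comp_chartDeriv (c.map_source hts)
      rw [← hc, c.left_inv hts] at h4
      have h5 : (flowDeriv (E := E) φ (-t) (φ t p.proj)).comp (flowDeriv φ t p.proj) =
          .id ℝ E := by
        rw [← hφ.flowDeriv_add, neg_add_cancel, hφ.flowDeriv_zero]
      rw [h1, h2, hpp]
      ext v
      have h6 (v : E) := congr($h4 v)
      have h7 (v : E) := congr($h5 v)
      simp only [ContinuousLinearMap.comp_apply, ContinuousLinearMap.id_apply] at h6 h7 ⊢
      rw [h6, h7]
    have h4 := h2.unique ((hasDerivAt_const _ _).congr_of_eventuallyEq h3)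
    rw [hD0, ContinuousLinearMap.comp_id, hγ0] at h4
    rw [hpp] at h4 ⊢
    exact eq_neg_of_add_eq_zero_left h4

theorem isHamiltonianVectorField_cotangentLift {X : (q : M) → TangentSpace 𝓘(ℝ, E) q}
    (hXs : IsSmoothVectorField 𝓘(ℝ, E) X) (hX : IsCompleteVectorField 𝓘(ℝ, E) X) :
    IsHamiltonianVectorField (cotangentModel E) (canonicalForm E M) (cotangentLift X hXs hX)
      (hamiltonianFunction X) where
  symplectic := isSymplecticForm_canonicalForm E M
  smooth_field := (isSmoothGlobalFlow_liftCotangent_flowEquiv hXs hX).isSmoothVectorField_generator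
  smooth_hamiltonian := contMDiff_hamiltonianFunction hXs
  contraction p w := by
    refine Eq.trans ?_ (mfderiv_hamiltonianFunction hXs p w).symm
    have key (Y w : E × (E →L[ℝ] ℝ)) (u : E) (ξ : E →L[ℝ] ℝ) (A : E →L[ℝ] E)
        (hY : Y = (u, -ξ.comp A)) : modelCanonicalForm E ![Y, w] = w.2 u + ξ (A w.1) := by
      rw [hY, modelCanonicalForm_apply]
      simp
    exact (congrArg (fun α : (E × (E →L[ℝ] ℝ)) [⋀^Fin 2]→L[ℝ] ℝ ↦ α ![cotangentLift X hXs hX p, w])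
      (formValue_canonicalForm E M p)).trans (key _ w _ _ _ (cotangentLift_inChart hXs hX p))

end Hamiltonian

theorem mainTheorem8 {E : Type*} [NormedAddCommGroup E] [NormedSpace ℝ E] [FiniteDimensional ℝ E]
    {M : Type*} [TopologicalSpace M] [T2Space M] [ChartedSpace E M]
    [IsManifold 𝓘(ℝ, E) ∞ M]
    (X : (q : M) → TangentSpace 𝓘(ℝ, E) q) (hXs : IsSmoothVectorField 𝓘(ℝ, E) X)
    (hX : IsCompleteVectorField 𝓘(ℝ, E) X) :
    -- the flow of `X` is a smooth global flow, and so are its lifts to the cotangent bundle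
    IsSmoothGlobalFlow 𝓘(ℝ, E) (flowOf 𝓘(ℝ, E) X hX) ∧
    IsSmoothGlobalFlow (cotangentModel E)
      (fun t (p : CotangentBundle E M) ↦ liftCotangent (flowEquiv 𝓘(ℝ, E) X hXs hX t) p) ∧
    -- the cotangent lift is a smooth complete vector field, which generates the lifted flow
    IsSmoothVectorField (cotangentModel E) (cotangentLift X hXs hX) ∧
    (∃ hL : IsCompleteVectorField (cotangentModel E) (cotangentLift X hXs hX),
      ∀ (t : ℝ) (p : CotangentBundle E M),
        flowOf (cotangentModel E) (cotangentLift X hXs hX) hL t p =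
          liftCotangent (flowEquiv 𝓘(ℝ, E) X hXs hX t) p) ∧
    -- it is Hamiltonian for the canonical symplectic form, with Hamiltonian `p_q ↦ p (X_q)`
    IsHamiltonianVectorField (cotangentModel E) (canonicalForm E M) (cotangentLift X hXs hX)
      (hamiltonianFunction X) := by

  have hψ := isSmoothGlobalFlow_liftCotangent_flowEquiv hXs hX
  -- `cotangentLift` unfolds to `flowGenerator` of the lifted flow, so the general facts on
  -- generators apply directly.
  exact ⟨isSmoothGlobalFlow_flowOf hXs hX, hψ, hψ.isSmoothVectorField_generator,
    ⟨hψ.isCompleteVectorField_generator, hψ.flowOf_generator _⟩,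
    isHamiltonianVectorField_cotangentLift hXs hX⟩
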